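/- Let $(R,\mathfrak m_R)$ be a complete Noetherian local domain of Krull dimension one. Let $\mathcal X$ be a connected projective normal curve over $R$, that is, a connected normal scheme (all of whose local rings are integrally closed domains) with a projective dominant morphism $\mathcal X\to\operatorname{Spec} R$ all of whose fibers have dimension one. Such an $\mathcal X$ is integral; let $F$ be its function field and let $X\subset\mathcal X$ be the closed fiber. Let $U\subseteq X$ be an arbitrary subset that is contained in some affine open subset of $\mathcal X$, let $R_U=\bigcap_{x\in U}\mathcal O_{\mathcal X,x}\subseteq F$ be the ring of rational functions that are regular at every point of $U$ (so $R_U=F$ if $U=\emptyset$), and let $\widehat R_U$ be the $\mathfrak m_RR_U$-adic completion of $R_U$. Let $Q$ be a maximal ideal of $\widehat R_U$ and let $P_i$ be a minimal prime ideal of $\widehat R_U$ with $P_i\subseteq Q$. Then the canonical homomorphism $$\varphi\colon R_U\to(\widehat R_U/P_i)_Q$$ is injective and Weierstrass, where Weierstrass means that for every $b\in(\widehat R_U/P_i)_Q$ there are an $a\in R_U$ and a unit $b'$ of $(\widehat R_U/P_i)_Q$ with $b=\varphi(a)\,b'$. -/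

import Mathlib

open AlgebraicGeometry CategoryTheory

universe u

attribute [local instance] MvPolynomial.gradedAlgebra

/-- A ring homomorphism `φ : A → B` is Weierstrass if every `b : B` is of the form `φ a * b'`
with `a : A` and `b'` a unit of `B`. -/
def IsWeierstrass {A B : Type*} [CommRing A] [CommRing B] (φ : A →+* B) : Prop :=
  ∀ b : B, ∃ (a : A) (b' : Bˣ), b = φ a * b'

/-- Projective `n`-space over `R`, as `Proj R[x₀, …, xₙ]`. -/
noncomputable def projSpace (R : Type u) [CommRing R] (n : ℕ) : Scheme.{u} :=
  Proj (MvPolynomial.homogeneousSubmodule (Fin (n + 1)) R)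

/-- The structure morphism of projective `n`-space over `R`. -/
noncomputable def projSpaceToSpec (R : Type u) [CommRing R] (n : ℕ) :
    projSpace R n ⟶ Spec (.of R) :=
  Proj.toSpecZero (MvPolynomial.homogeneousSubmodule (Fin (n + 1)) R) ≫
    Spec.map (CommRingCat.ofHom
      (algebraMap R (MvPolynomial.homogeneousSubmodule (Fin (n + 1)) R 0)))

/-- A morphism to `Spec R` is projective if it factors as a closed immersion into some
projective space over `R` followed by the structure morphism. -/
def IsProjectiveOver {R : Type u} [CommRing R] {X : Scheme.{u}} (f : X ⟶ Spec (.of R)) : Prop :=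
  ∃ (n : ℕ) (i : X ⟶ projSpace R n), IsClosedImmersion i ∧ i ≫ projSpaceToSpec R n = f

/-- A scheme is normal if all its local rings are integrally closed domains. -/
def IsNormalScheme (X : Scheme.{u}) : Prop :=
  ∀ x : X, IsDomain (X.presheaf.stalk x) ∧ IsIntegrallyClosed (X.presheaf.stalk x)

/-- A connected projective normal curve over `R` that dominates `Spec R`; being a curve over `R`
means that all fibers of the structure morphism have dimension one. -/
structure ProjectiveNormalCurve (R : Type u) [CommRing R] where
  /-- the total space -/
  X : Scheme.{u}
  /-- the structure morphism -/
  f : X ⟶ Spec (.of R)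
  connected : ConnectedSpace X
  normal : IsNormalScheme X
  projective : IsProjectiveOver f
  dominant : IsDominant f
  fiber_dim : ∀ y : Spec (.of R), topologicalKrullDim (f.fiber y) = 1

/-- Projective schemes over a Noetherian ring are Noetherian. -/
theorem IsProjectiveOver.isNoetherian {R : Type u} [CommRing R] [IsNoetherianRing R]
    {X : Scheme.{u}} {f : X ⟶ Spec (.of R)} (hf : IsProjectiveOver f) : IsNoetherian X := by
  obtain ⟨n, i, hi, -⟩ := hf
  let 𝒜 := MvPolynomial.homogeneousSubmodule (Fin (n + 1)) R
  have : IsScalarTower R (𝒜 0) (MvPolynomial (Fin (n + 1)) R) :=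
    ⟨fun r a p => smul_mul_assoc r (a : MvPolynomial (Fin (n + 1)) R) p⟩
  have hfin : Algebra.FiniteType (𝒜 0) (MvPolynomial (Fin (n + 1)) R) :=
    Algebra.FiniteType.of_restrictScalars_finiteType R (𝒜 0) (MvPolynomial (Fin (n + 1)) R)
  have hsurj : Function.Surjective (algebraMap R (𝒜 0)) := by
    rintro ⟨p, hp⟩
    have hp' : p ∈ MvPolynomial.homogeneousSubmodule (Fin (n + 1)) R 0 := hp
    rw [MvPolynomial.homogeneousSubmodule_zero] at hp'
    obtain ⟨r, rfl⟩ := Submodule.mem_one.1 hp'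
    exact ⟨r, rfl⟩
  have hN : IsNoetherianRing (𝒜 0) := isNoetherianRing_of_surjective _ _ _ hsurj
  let g : X ⟶ Spec (.of (𝒜 0)) := (i : X ⟶ Proj 𝒜) ≫ Proj.toSpecZero 𝒜
  have hi' : IsClosedImmersion (i : X ⟶ Proj 𝒜) := hi
  have h0 : IsProper (Proj.toSpecZero 𝒜) := inferInstance
  have h0' : IsProper (i : X ⟶ Proj 𝒜) := inferInstance
  have hg : IsProper g := MorphismProperty.comp_mem (W := @IsProper) _ _ h0' h0
  have h1 : LocallyOfFiniteType g := inferInstance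
  have h2 : QuasiCompact g := inferInstance
  have h3 : IsLocallyNoetherian X := LocallyOfFiniteType.isLocallyNoetherian g
  have h4 : CompactSpace X := QuasiCompact.compactSpace_of_compactSpace g
  exact { }

/-- A connected Noetherian scheme whose local rings are domains is integral. -/
theorem isIntegral_of_connected_of_stalk {X : Scheme.{u}} [IsNoetherian X] [ConnectedSpace X]
    (h : ∀ x : X, IsDomain (X.presheaf.stalk x)) : IsIntegral X := by
  have key : ∀ x : X, ∃ g : X, ∀ Z ∈ irreducibleComponents X, x ∈ Z → Z = closure {g} := by
    intro x
    have := h x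
    refine ⟨X.fromSpecStalk x (⊥ : PrimeSpectrum (X.presheaf.stalk x)), fun Z hZ hx => ?_⟩
    have hZc := isClosed_of_mem_irreducibleComponents Z hZ
    obtain ⟨z, hz⟩ := QuasiSober.sober hZ.1 hZc
    have hzx : z ⤳ x := specializes_iff_mem_closure.2 (hz.def.symm ▸ hx)
    have : z ∈ Set.range (X.fromSpecStalk x) := by
      rw [Scheme.range_fromSpecStalk]; exact hzx
    obtain ⟨p, rfl⟩ := this
    have hs : (⊥ : PrimeSpectrum (X.presheaf.stalk x)) ⤳ p :=
      (PrimeSpectrum.le_iff_specializes _ _).1 bot_le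
    have hs' := hs.map (X.fromSpecStalk x).continuous
    have hle : Z ≤ closure {X.fromSpecStalk x (⊥ : PrimeSpectrum (X.presheaf.stalk x))} := by
      rw [← hz.def]
      exact closure_minimal (Set.singleton_subset_iff.2 hs'.mem_closure) isClosed_closure
    exact le_antisymm hle (hZ.2 isIrreducible_singleton.closure hle)
  have hfin := TopologicalSpace.NoetherianSpace.finite_irreducibleComponents (α := X)
  obtain ⟨x₀⟩ : Nonempty X := inferInstance
  let Z := irreducibleComponent x₀
  have hZ : Z ∈ irreducibleComponents X := irreducibleComponent_mem_irreducibleComponents x₀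
  have hcompl : Zᶜ = ⋃ W ∈ irreducibleComponents X \ {Z}, W := by
    ext y
    simp only [Set.mem_compl_iff, Set.mem_iUnion, exists_prop]
    obtain ⟨g, hg⟩ := key y
    constructor
    · intro hy
      refine ⟨irreducibleComponent y, ⟨irreducibleComponent_mem_irreducibleComponents y, ?_⟩,
        mem_irreducibleComponent⟩
      intro e
      exact hy ((Set.mem_singleton_iff.1 e) ▸ mem_irreducibleComponent)
    · rintro ⟨W, ⟨hW, hne⟩, hyW⟩ hy
      exact hne ((hg W hW hyW).trans (hg Z hZ hy).symm)
  have hclopen : IsClopen Z := by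
    refine ⟨isClosed_of_mem_irreducibleComponents Z hZ, ?_⟩
    rw [← isClosed_compl_iff, hcompl]
    exact hfin.sdiff.isClosed_biUnion fun W hW => isClosed_of_mem_irreducibleComponents W hW.1
  have huniv : Z = Set.univ := hclopen.eq_univ ⟨x₀, mem_irreducibleComponent⟩
  have hirr : IrreducibleSpace X := by
    have : IsIrreducible (Set.univ : Set X) := huniv ▸ hZ.1
    exact { isPreirreducible_univ := this.2, toNonempty := ⟨x₀⟩ }
  have hred : ∀ x : X, _root_.IsReduced (X.presheaf.stalk x) := fun x => by
    have := h x; infer_instance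
  have : IsReduced X := isReduced_of_isReduced_stalk X
  exact isIntegral_of_irreducibleSpace_of_isReduced X

/-- For a prime ideal `Q` of a ring `B` and an ideal `P`, the localization `(B / P)_Q` at the
image of `B \ Q`. -/
abbrev QuotientLocalization {B : Type u} [CommRing B] (P Q : Ideal B) [Q.IsPrime] :
    Type u :=
  Localization (Algebra.algebraMapSubmonoid (B ⧸ P) Q.primeCompl)

namespace ProjectiveNormalCurve

variable {R : Type u} [CommRing R] [IsNoetherianRing R] (C : ProjectiveNormalCurve R)

instance isIntegral : IsIntegral C.X :=
  haveI := C.projective.isNoetherian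
  haveI := C.connected
  isIntegral_of_connected_of_stalk fun x => (C.normal x).1

/-- The closed fiber, as a subset of the curve. -/
def closedFiber [IsLocalRing R] : Set C.X :=
  C.f ⁻¹' {IsLocalRing.closedPoint R}

/-- The ring `R_U` of rational functions that are regular at all points of `U`, as a subring of
the function field: a rational function is regular at `x` if it comes from the local ring
at `x`. -/
noncomputable def regularOn (U : Set C.X) : Subring C.X.functionField :=
  ⨅ x ∈ U, (algebraMap (C.X.presheaf.stalk x) C.X.functionField).range

/-- The canonical homomorphism from `R` to the function field. -/
noncomputable def toFunctionField : R →+* C.X.functionField :=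
  (C.X.presheaf.germ ⊤ (genericPoint C.X) trivial).hom.comp
    (C.f.appTop.hom.comp (Scheme.ΓSpecIso (.of R)).inv.hom)

theorem toFunctionField_mem (U : Set C.X) (r : R) : C.toFunctionField r ∈ C.regularOn U := by
  simp only [regularOn, Subring.mem_iInf]
  intro x _
  have : Nonempty (⊤ : C.X.Opens) := ⟨⟨x, trivial⟩⟩
  exact ⟨_, Scheme.algebraMap_germ_eq_germToFunctionField C.X (U := ⊤) (x := x) trivial _⟩

/-- The canonical homomorphism `R → R_U`. -/
noncomputable def toRegularOn (U : Set C.X) : R →+* C.regularOn U :=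
  C.toFunctionField.codRestrict _ (C.toFunctionField_mem U)

/-- The ideal `𝔪_R R_U` of `R_U`. -/
noncomputable def idealOn [IsLocalRing R] (U : Set C.X) : Ideal (C.regularOn U) :=
  (IsLocalRing.maximalIdeal R).map (C.toRegularOn U)

/-- The `𝔪_R R_U`-adic completion of `R_U`. -/
abbrev completionOn [IsLocalRing R] (U : Set C.X) : Type u :=
  AdicCompletion (C.idealOn U) (C.regularOn U)

/-- The canonical homomorphism from `R_U` to the localization at `Q` of the quotient of its
completion by `P`. -/
noncomputable def toLocalization [IsLocalRing R] (U : Set C.X)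
    (P Q : Ideal (C.completionOn U)) [Q.IsPrime] :
    C.regularOn U →+* QuotientLocalization P Q :=
  ((algebraMap (C.completionOn U ⧸ P) (QuotientLocalization P Q)).comp
    (Ideal.Quotient.mk P)).comp (algebraMap (C.regularOn U) (C.completionOn U))

end ProjectiveNormalCurve

/-! Let `A` be the ring of a nonempty affine open containing `U`, `W = R_U`, and `B` the localized
quotient `(Ŵ/P)_Q` of the completion `Ŵ`. Then `A` is of finite type over `R`, with no chain of
three primes in its closed fiber, and `𝔪_R` lies in the radical of a principal ideal `(t)`. The plan
is to control `W`, `Ŵ` and `B` through `A`.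

The geometric point is that each prime `N` of `W` over `𝔪_R` contracts into the prime of some point
of `U` (`exists_comap_le_of_regular`), so that elements of `W` are fractions over `A` at `N`
(`HasDenominators`). Otherwise one picks `g ≠ 0` in `p = N ∩ A` whose zero locus meets the closed
fiber in isolated points at the points of `U`. Zariski's main theorem and completeness of `R`
separate these points from `p` by idempotents modulo `g`. This gives `F ∉ p` with `F / g` regular on
`U`, whence `F ∈ gW ⊆ N`, a contradiction.

Consequently, ideals of `W` containing a power of `𝔪_R W` are extended from `A`, which makes `Ŵ`
Noetherian. By Artin-Rees and Krull's intersection theorem, nonzero elements of `W` are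
nonzerodivisors in the localization of `Ŵ` at `Q`. Minimal primes below `Q` therefore contract to
zero, and `φ` is injective.

For the Weierstrass property, let `b ≠ 0` in `B` and let `𝔠` be the `t`-saturation of `(b)`. The
principal ideal theorem and the one-dimensional fiber of `A` show that `B / 𝔠` has finite closed
fiber, so it is finite over `R`. Fractions of `A` are dense in `B`, hence surject onto `B / 𝔠` by
Nakayama and then onto `B / (b)`. It follows that `(b)` is generated by such fractions. As `(b)` is
principal and `B` is local, one of them is `b` up to a unit (`exists_mem_associated_of_dense`). -/

/-! ### Complete modules and a Noetherian criterion -/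

section AdicallyComplete

/-- Finite powers of a complete ring are complete. -/
theorem IsPrecomplete.pi_fin {R : Type*} [CommRing R] (I : Ideal R) [IsPrecomplete I R] (n : ℕ) :
    IsPrecomplete I (Fin n → R) := by
  refine ⟨fun x hx => ?_⟩
  have hsm : ∀ (k : ℕ) (y : Fin n → R), y ∈ (I ^ k • ⊤ : Submodule R (Fin n → R)) ↔
      ∀ i, y i ∈ I ^ k := fun k y => by
    refine ⟨fun hy i => ?_, fun hy => ?_⟩
    · refine Submodule.smul_induction_on (p := fun y => y i ∈ I ^ k) hy ?_ ?_
      · exact fun r hr z _ => Ideal.mul_mem_right _ _ hr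
      · exact fun a b ha hb => Ideal.add_mem _ ha hb
    · rw [pi_eq_sum_univ' y]
      exact Submodule.sum_mem _ fun i _ => Submodule.smul_mem_smul (hy i) trivial
  have hc : ∀ i, ∃ L, ∀ k, x k i ≡ L [SMOD (I ^ k • ⊤ : Submodule R R)] := fun i => by
    refine IsPrecomplete.prec inferInstance fun {a b} hab => ?_
    have := hx hab
    rw [SModEq.sub_mem, hsm] at this
    rw [SModEq.sub_mem]
    simpa using this i
  choose L hL using hc
  refine ⟨L, fun k => ?_⟩
  rw [SModEq.sub_mem, hsm]
  intro i
  have := hL i k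
  rw [SModEq.sub_mem] at this
  simpa using this

/-- Completeness passes to quotient modules. -/
theorem IsPrecomplete.of_surjective {R M N : Type*} [CommRing R] {I : Ideal R} [AddCommGroup M]
    [Module R M] [AddCommGroup N] [Module R N] [IsPrecomplete I M] (f : M →ₗ[R] N)
    (hf : Function.Surjective f) : IsPrecomplete I N := by
  rw [← AdicCompletion.of_surjective_iff]
  intro y
  obtain ⟨x, rfl⟩ := AdicCompletion.map_surjective I hf y
  obtain ⟨z, rfl⟩ := AdicCompletion.of_surjective I M x
  exact ⟨f z, (AdicCompletion.map_of I f z).symm⟩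

/-- Finite modules over a complete ring are complete. -/
theorem IsPrecomplete.of_finite {R M : Type*} [CommRing R] (I : Ideal R) [IsPrecomplete I R]
    [AddCommGroup M] [Module R M] [Module.Finite R M] : IsPrecomplete I M := by
  obtain ⟨n, f, hf⟩ := Module.Finite.exists_fin' R M
  have := IsPrecomplete.pi_fin I n
  exact IsPrecomplete.of_surjective f hf

/-- Over a complete ring, generators modulo `I` of a separated module are generators. -/
theorem Submodule.span_eq_top_of_isPrecomplete {R M : Type*} [CommRing R] {I : Ideal R}
    [IsPrecomplete I R] [AddCommGroup M] [Module R M] [IsHausdorff I M] {s : Set M}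
    (hs : s.Finite) (h : Submodule.span R s ⊔ I • ⊤ = ⊤) : Submodule.span R s = ⊤ := by
  obtain ⟨n, f, hf⟩ : ∃ (n : ℕ) (f : Fin n → M), Set.range f = s := by
    have := hs.fintype
    exact ⟨_, fun i => ((Fintype.equivFin s).symm i : M), by
      rw [Set.range_comp' (Subtype.val), (Fintype.equivFin s).symm.range_eq_univ]; simp⟩
  have hpre := IsPrecomplete.pi_fin I n
  have hrange : LinearMap.range (Fintype.linearCombination R f) = Submodule.span R s := by
    rw [Fintype.range_linearCombination, hf]
  rw [← hrange, LinearMap.range_eq_top]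
  refine surjective_of_mkQ_comp_surjective (I := I) ?_
  rw [← LinearMap.range_eq_top, LinearMap.range_comp, hrange, Submodule.map_mkQ_eq_top, sup_comm, h]

/-- A complete ring in which all ideals containing a power of `I` are finitely generated is
Noetherian if `I` is the radical of a principal ideal. -/
theorem isNoetherianRing_of_isAdicComplete {S : Type*} [CommRing S] {I : Ideal S}
    [IsAdicComplete I S] {t : S} (htI : t ∈ I) (hI : I.FG) (hIt : I ≤ (Ideal.span {t}).radical)
    (h : ∀ (J : Ideal S) (n : ℕ), I ^ n ≤ J → J.FG) : IsNoetherianRing S := by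
  refine IsNoetherianRing.of_prime fun p hp => ?_
  by_cases htp : t ∈ p
  · refine h p 1 ?_
    rw [pow_one]
    exact hIt.trans (hp.radical_le_iff.2 (by simpa [Ideal.span_le] using htp))
  obtain ⟨n, hn⟩ := Ideal.exists_pow_le_of_le_radical_of_fg hIt hI
  -- Only primes need checking, by Cohen's theorem. For `t ∉ p`, the ideal `p + (t)` still contains
  -- a power of `I`, so `p` is finitely generated modulo `t`.
  have hfg : (p ⊔ Ideal.span {t}).FG := h _ n (hn.trans le_sup_right)
  have hfg' : (Submodule.map (Ideal.span {t}).mkQ p).FG := by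
    have := Submodule.FG.map (Ideal.span {t}).mkQ hfg
    rwa [Submodule.map_sup, Submodule.mkQ_map_self, sup_bot_eq] at this
  obtain ⟨s, hs⟩ := hfg'
  have hsp : ∀ x ∈ s, ∃ y ∈ p, (Ideal.span {t}).mkQ y = x := fun x hx =>
    Submodule.mem_map.1 (hs ▸ Submodule.subset_span hx)
  choose! g hgp hg using hsp
  have hle : ∀ x ∈ p, ∃ y ∈ Submodule.span S (g '' s), x - y ∈ Ideal.span {t} := fun x hx => by
    have : (Ideal.span {t}).mkQ x ∈ (Submodule.span S (g '' s)).map (Ideal.span {t}).mkQ := by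
      rw [Submodule.map_span, ← Set.image_comp,
        Set.image_congr (f := (Ideal.span {t}).mkQ ∘ g) (g := id) (fun a ha => hg a ha),
        Set.image_id, hs]
      exact Submodule.mem_map_of_mem hx
    obtain ⟨y, hy, e⟩ := Submodule.mem_map.1 this
    exact ⟨y, hy, (Submodule.Quotient.eq _).1 e.symm⟩
  have hgp' : Submodule.span S (g '' s) ≤ p :=
    Submodule.span_le.2 (by rintro _ ⟨x, hx, rfl⟩; exact hgp x hx)
  have hH : IsHausdorff I p := ⟨fun x hx => Subtype.ext <| IsHausdorff.haus (I := I) (M := S)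
    inferInstance x.1 fun n => by
      have := hx n
      rw [SModEq.zero] at this ⊢
      have := Submodule.mem_map_of_mem (f := p.subtype) this
      rw [Submodule.map_smul''] at this
      exact Submodule.smul_mono le_rfl le_top this⟩
  let u : Set p := Subtype.val ⁻¹' (g '' s)
  have hu : Subtype.val '' u = g '' s := by
    ext y
    refine ⟨by rintro ⟨z, hz, rfl⟩; exact hz, fun hy => ?_⟩
    have hyp : y ∈ p := by obtain ⟨x, hx, rfl⟩ := hy; exact hgp x hx
    exact ⟨⟨y, hyp⟩, hy, rfl⟩
  have hufin : u.Finite := (s.finite_toSet.image g).preimage Subtype.val_injective.injOn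
  -- Since `p` is prime and `t ∉ p`, `p ∩ (t) = t p ⊆ I p`. Generators of `p` modulo `t` thus
  -- generate it modulo `I p`, and completeness removes the error.
  have hspan : Submodule.span S u = ⊤ := by
    refine Submodule.span_eq_top_of_isPrecomplete (I := I) hufin (top_le_iff.1 fun x _ => ?_)
    obtain ⟨y, hy, hxy⟩ := hle x.1 x.2
    obtain ⟨z, hz⟩ := Ideal.mem_span_singleton'.1 hxy
    have hzp : z ∈ p := (hp.mem_or_mem (hz ▸ p.sub_mem x.2 (hgp' hy) : z * t ∈ p)).resolve_right htp
    have hyu : (⟨y, hgp' hy⟩ : p) ∈ Submodule.span S u := by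
      rw [← hu, ← Submodule.coe_subtype, ← Submodule.map_span] at hy
      obtain ⟨w, hw, e⟩ := Submodule.mem_map.1 hy
      convert hw
      exact e.symm
    have : x = ⟨y, hgp' hy⟩ + t • ⟨z, hzp⟩ := Subtype.ext (by
      change x.1 = y + t * z
      rw [mul_comm, hz]; ring)
    rw [this]
    exact Submodule.add_mem_sup hyu (Submodule.smul_mem_smul htI trivial)
  have := Module.Finite.iff_fg.1 (⟨Submodule.fg_def.2 ⟨u, hufin, hspan⟩⟩ : Module.Finite S p)
  exact this

end AdicallyComplete

/-! ### Idempotents in finite algebras over a complete local ring -/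

section Henselian

open IsLocalRing

theorem liesOver_maximalIdeal_of_map_le {R D : Type*} [CommRing R] [IsLocalRing R] [CommRing D]
    [Algebra R D] {q : Ideal D}
    [hq : q.IsPrime] (h : (maximalIdeal R).map (algebraMap R D) ≤ q) :
    q.LiesOver (maximalIdeal R) :=
  ⟨(((maximalIdeal.isMaximal R).eq_of_le (hq.under R).ne_top (Ideal.map_le_iff_le_comap.1 h)))⟩

variable {R : Type*} [CommRing R] [IsLocalRing R] [IsNoetherianRing R]
  [IsAdicComplete (maximalIdeal R) R]

/-- A finite algebra over a complete Noetherian local ring is complete. -/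
theorem IsAdicComplete.of_finite_algebra (D : Type*) [CommRing D] [Algebra R D]
    [Module.Finite R D] : IsAdicComplete ((maximalIdeal R).map (algebraMap R D)) D := by
  have h1 : IsHausdorff (maximalIdeal R) D := inferInstance
  have h2 : IsPrecomplete (maximalIdeal R) D := IsPrecomplete.of_finite _
  exact { haus' := (IsHausdorff.map_algebraMap_iff.2 h1).haus'
          prec' := (IsPrecomplete.map_algebraMap_iff.2 h2).prec' }

/-- Idempotents lift along `D → D / I` if `D` is Henselian at `I`. -/
theorem HenselianRing.exists_isIdempotentElem {D : Type*} [CommRing D] (I : Ideal D)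
    [HenselianRing D I] {a : D} (ha : a * a - a ∈ I) : ∃ e : D, IsIdempotentElem e ∧ e - a ∈ I := by
  let p : Polynomial D := Polynomial.X ^ (1 + 1) - Polynomial.X
  have hm : p.Monic := Polynomial.monic_X_pow_sub
    (Polynomial.degree_X_le.trans_lt (by norm_num))
  have hev : ∀ x, p.eval x = x * x - x := fun x => by simp [p, pow_two]
  have hder : p.derivative.eval a = 2 * a - 1 := by simp [p]; ring
  -- Modulo `I`, `a` is a simple root of `X ^ 2 - X`: the derivative `2 * a - 1` has square `1 + 4 *
  -- (a * a - a)`, hence is its own inverse there.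
  obtain ⟨e, he, hea⟩ := HenselianRing.is_henselian (I := I) p hm a (by rwa [hev]) (by
      rw [hder]
      refine IsUnit.of_mul_eq_one (Ideal.Quotient.mk I (2 * a - 1)) ?_
      rw [← map_mul, ← map_one (Ideal.Quotient.mk I), Ideal.Quotient.eq]
      have : (2 * a - 1) * (2 * a - 1) - 1 = 4 * (a * a - a) := by ring
      rw [this]
      exact I.mul_mem_left 4 ha)
  refine ⟨e, ?_, hea⟩
  rw [Polynomial.IsRoot, hev, sub_eq_zero] at he
  exact he

/-- In a finite algebra over a complete Noetherian local ring, every maximal ideal can be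
separated from the others by an idempotent. -/
theorem exists_isIdempotentElem_of_finite {D : Type*} [CommRing D] [Algebra R D]
    [Module.Finite R D] (q : Ideal D) [hq : q.IsPrime]
    (hmq : (maximalIdeal R).map (algebraMap R D) ≤ q) :
    ∃ e : D, IsIdempotentElem e ∧ e ∉ q ∧ ∀ n : Ideal D, n.IsPrime →
      (maximalIdeal R).map (algebraMap R D) ≤ n → n ≠ q → e ∈ n := by
  set I := (maximalIdeal R).map (algebraMap R D) with hI
  have hc : IsAdicComplete I D := IsAdicComplete.of_finite_algebra D
  have hN : IsNoetherianRing D := IsNoetherianRing.of_finite R D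
  have hint : Algebra.IsIntegral R D := inferInstance
  have hmax : ∀ n : Ideal D, n.IsPrime → I ≤ n → n.IsMaximal := fun n hn hIn => by
    have := liesOver_maximalIdeal_of_map_le hIn
    exact Ideal.isMaximal_of_isIntegral_of_isMaximal_comap n
      ((this.over : maximalIdeal R = n.under R) ▸ (maximalIdeal.isMaximal R))
  have hart : IsArtinianRing (D ⧸ I) := by
    rw [isArtinianRing_iff_isNoetherianRing_krullDimLE_zero]
    refine ⟨inferInstance, ?_⟩
    refine Ring.KrullDimLE.mk₀ fun J hJ => ?_
    have := hmax (J.comap (Ideal.Quotient.mk I)) inferInstance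
      (Ideal.mk_ker (I := I).symm.le.trans (Ideal.comap_mono bot_le))
    have := Ideal.IsMaximal.map_of_surjective_of_ker_le (m := J.comap (Ideal.Quotient.mk I))
      Ideal.Quotient.mk_surjective (Ideal.comap_mono bot_le)
    rwa [Ideal.map_comap_of_surjective _ Ideal.Quotient.mk_surjective] at this
  have hprime : ∀ n : Ideal D, n.IsPrime → I ≤ n → (n.map (Ideal.Quotient.mk I)).IsPrime :=
    fun n hn hIn => Ideal.map_isPrime_of_surjective Ideal.Quotient.mk_surjective
      (by rwa [Ideal.mk_ker])
  have hmem : ∀ n : Ideal D, I ≤ n → ∀ x : D,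
      Ideal.Quotient.mk I x ∈ n.map (Ideal.Quotient.mk I) ↔ x ∈ n := fun n hIn x => by
    rw [← Ideal.mem_comap, Ideal.comap_map_of_surjective _ Ideal.Quotient.mk_surjective,
      ← RingHom.ker_eq_comap_bot, Ideal.mk_ker, sup_eq_left.2 hIn]
  let q' : PrimeSpectrum (D ⧸ I) := ⟨q.map (Ideal.Quotient.mk I), hprime q hq hmq⟩
  -- The spectrum of the Artinian ring `D ⧸ I` is discrete, so the point of `q` is cut out by an
  -- idempotent, which then lifts to `D`.
  obtain ⟨ε, hε, hεq⟩ := PrimeSpectrum.isClopen_iff.1 (isClopen_discrete {q'})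
  obtain ⟨a, rfl⟩ := Ideal.Quotient.mk_surjective ε
  have ha : a * a - a ∈ I := by
    rw [← Ideal.Quotient.eq, map_mul]; exact hε
  obtain ⟨e, he, hea⟩ := HenselianRing.exists_isIdempotentElem I ha
  have hiff : ∀ n : Ideal D, I ≤ n → (e ∈ n ↔ a ∈ n) := fun n hn =>
    ⟨fun h => by simpa using n.sub_mem h (hn hea), fun h => by simpa using n.add_mem (hn hea) h⟩
  refine ⟨e, he, ?_, fun n hn hIn hne => ?_⟩
  · rw [hiff q hmq, ← hmem q hmq]
    have : q' ∈ ({q'} : Set _) := rfl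
    rw [hεq] at this
    exact this
  · rw [hiff n hIn, ← hmem n hIn]
    by_contra hcon
    have : (⟨n.map (Ideal.Quotient.mk I), hprime n hn hIn⟩ : PrimeSpectrum (D ⧸ I)) ∈
        ({q'} : Set _) := by rw [hεq]; exact hcon
    have h2 : n.map (Ideal.Quotient.mk I) = q.map (Ideal.Quotient.mk I) :=
      congrArg PrimeSpectrum.asIdeal this
    exact hne (Ideal.ext fun x => by rw [← hmem n hIn, h2, hmem q hmq])

end Henselian

/-! ### Isolated points of the closed fiber and Zariski's main theorem -/

section IsolatedPoint

open IsLocalRing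

/-- A finite type algebra over a local ring is quasi-finite at the isolated points of its closed
fiber. -/
theorem Algebra.QuasiFiniteAt.of_mem_minimalPrimes {R D : Type*} [CommRing R] [IsLocalRing R]
    [CommRing D] [IsNoetherianRing D] [Algebra R D] [Algebra.FiniteType R D] (q : Ideal D)
    [hq : q.IsMaximal]
    (hmin : q ∈ ((maximalIdeal R).map (algebraMap R D)).minimalPrimes) :
    Algebra.QuasiFiniteAt R q := by
  classical
  let I := (maximalIdeal R).map (algebraMap R D)
  have hfin : I.minimalPrimes.Finite := Ideal.finite_minimalPrimes_of_isNoetherianRing D I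
  -- `c` lies in all minimal primes of the closed fiber other than `q`, so its basic open set meets
  -- the closed fiber only in `q`.
  obtain ⟨c, hc, hcq⟩ : ∃ c ∈ (hfin.toFinset.erase q).inf _root_.id, c ∉ q := by
    by_contra! hcon
    obtain ⟨n, hn, hnq⟩ := (Ideal.IsPrime.inf_le' hq.isPrime).1
      (show (hfin.toFinset.erase q).inf _root_.id ≤ q from
      fun x hx => hcon x hx)
    rw [Finset.mem_erase, Set.Finite.mem_toFinset] at hn
    exact hn.1 (le_antisymm hnq (hmin.2 hn.2.1 hnq))
  have key : ∀ n : Ideal D, n.IsPrime → I ≤ n → c ∉ n → n = q := fun n hn hIn hcn => by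
    obtain ⟨n', hn', hle⟩ := Ideal.exists_minimalPrimes_le hIn
    have : n' = q := by
      by_contra hne
      exact hcn (hle (Finset.inf_le (f := _root_.id)
        (Finset.mem_erase.2 ⟨hne, hfin.mem_toFinset.2 hn'⟩) hc))
    exact (hq.eq_of_le hn.ne_top (this ▸ hle)).symm
  have hover := liesOver_maximalIdeal_of_map_le (R := R) hmin.1.2
  refine Algebra.QuasiFiniteAt.of_isOpen_singleton_fiber (⟨q, hq.isPrime⟩ : PrimeSpectrum D) ?_
  refine ⟨PrimeSpectrum.basicOpen c, (PrimeSpectrum.basicOpen c).isOpen, ?_⟩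
  ext ⟨x, hx⟩
  constructor
  · intro hcx
    refine Subtype.ext (PrimeSpectrum.ext (key x.asIdeal x.isPrime ?_ hcx))
    have h1 : x.comap (algebraMap R D) = PrimeSpectrum.comap (algebraMap R D) ⟨q, hq.isPrime⟩ := hx
    have h2 := congrArg PrimeSpectrum.asIdeal h1
    refine Ideal.map_le_iff_le_comap.2 ?_
    have h3 : (PrimeSpectrum.comap (algebraMap R D) x).asIdeal = q.under R := h2
    have h4 : maximalIdeal R = q.under R := hover.over
    rw [h4, ← h3]
    exact le_rfl
  · intro h
    obtain rfl : x = ⟨q, hq.isPrime⟩ := congrArg Subtype.val h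
    exact hcq

/-- An isolated point of the closed fiber of a finite type algebra over a complete Noetherian local
ring can be separated from the other points of the closed fiber by an idempotent. -/
theorem exists_isIdempotentElem_of_isolated {R D : Type*} [CommRing R] [IsLocalRing R]
    [IsNoetherianRing R] [IsAdicComplete (maximalIdeal R) R] [CommRing D] [Algebra R D]
    [Algebra.FiniteType R D] (q : Ideal D) [hq : q.IsMaximal]
    (hmin : q ∈ ((maximalIdeal R).map (algebraMap R D)).minimalPrimes) :
    ∃ e : D, IsIdempotentElem e ∧ e ∉ q ∧ ∀ n : Ideal D, n.IsPrime →
      (maximalIdeal R).map (algebraMap R D) ≤ n → n ≠ q → e ∈ n := by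
  have hN : IsNoetherianRing D := Algebra.FiniteType.isNoetherianRing R D
  have hqf := Algebra.QuasiFiniteAt.of_mem_minimalPrimes (R := R) q hmin
  -- By Zariski's main theorem a finite subalgebra `S'` agrees with `D` after inverting some `r ∉
  -- q`. The idempotent can therefore be found in `S'`.
  obtain ⟨S', hS', r, hrq, hbij⟩ :=
    (Algebra.ZariskisMainProperty.of_finiteType (R := R)
      q).exists_fg_and_exists_notMem_and_awayMap_bijective
  have hfin : Module.Finite R S' := ⟨(Submodule.fg_top _).mpr hS'⟩
  have hmul : ∀ x : D, ∃ (k : ℕ) (y : S'), (r : D) ^ k * x = y := fun x => by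
    obtain ⟨z, hz⟩ := hbij.2 (algebraMap D _ x)
    obtain ⟨y, ⟨_, k, rfl⟩, rfl⟩ := IsLocalization.exists_mk'_eq (.powers r) z
    rw [Localization.awayMap, IsLocalization.Away.map, IsLocalization.map_mk',
      IsLocalization.mk'_eq_iff_eq_mul, ← map_mul,
      IsLocalization.eq_iff_exists (.powers (S'.val.toRingHom r))] at hz
    obtain ⟨⟨_, j, rfl⟩, hj⟩ := hz
    refine ⟨j + k, r ^ j * y, ?_⟩
    have : (r : D) ^ j * (y : D) = (r : D) ^ j * (x * (r : D) ^ k) := hj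
    push_cast
    rw [this]; ring
  have hcomap : ∀ n : Ideal D, (maximalIdeal R).map (algebraMap R D) ≤ n →
      (maximalIdeal R).map (algebraMap R S') ≤ n.comap S'.val := fun n hn => by
    rw [Ideal.map_le_iff_le_comap] at hn ⊢
    exact hn
  obtain ⟨e, he, heq, hen⟩ := exists_isIdempotentElem_of_finite (R := R) (q.comap S'.val)
    (hcomap q hmin.1.2)
  refine ⟨e, congrArg Subtype.val he, heq, fun n hn hIn hne => ?_⟩
  refine hen (n.comap S'.val) inferInstance (hcomap n hIn) fun heq => hne ?_
  have hmem : ∀ y : S', (y : D) ∈ n ↔ (y : D) ∈ q := fun y => (Ideal.ext_iff.1 heq y)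
  -- A prime with the same trace on `S'` as `q` also misses `r`, so it is determined by that trace.
  have hrn : (r : D) ∉ n := fun h => hrq ((hmem r).1 h)
  refine hq.eq_of_le hn.ne_top ?_ |>.symm
  intro x hx
  obtain ⟨k, y, hy⟩ := hmul x
  have : (y : D) ∈ n := (hmem y).2 (hy ▸ q.mul_mem_left _ hx)
  rw [← hy] at this
  exact (hn.mem_or_mem this).resolve_left fun h => hrn (hn.mem_of_pow_mem _ h)

end IsolatedPoint

/-! ### Primes of a ring of regular functions over the closed fiber -/

section Denominators

open IsLocalRing

/-- Let `u` be an isolated point of the closed fiber of the zero locus of `g`. Then there is a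
multiple of `g` in the local ring at `u` that does not vanish at another given point `p` of the
closed fiber. -/
theorem exists_mul_mem_span_of_isolated {R A : Type*} [CommRing R] [IsLocalRing R]
    [IsNoetherianRing R] [IsAdicComplete (maximalIdeal R) R] [CommRing A] [Algebra R A]
    [Algebra.FiniteType R A] {g : A} {u p : Ideal A} [hu : u.IsMaximal] [hp : p.IsPrime]
    (hmin : u ∈ ((maximalIdeal R).map (algebraMap R A) ⊔ Ideal.span {g}).minimalPrimes)
    (hmp : (maximalIdeal R).map (algebraMap R A) ≤ p) (hgp : g ∈ p) (hne : p ≠ u) :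
    ∃ f s : A, f ∉ p ∧ s ∉ u ∧ s * f ∈ Ideal.span {g} := by
  set π := Ideal.Quotient.mk (Ideal.span {g}) with hπ
  have hπs : Function.Surjective π := Ideal.Quotient.mk_surjective
  have hker : RingHom.ker π = Ideal.span {g} := Ideal.mk_ker
  have hmap : (maximalIdeal R).map (algebraMap R (A ⧸ Ideal.span {g})) =
      ((maximalIdeal R).map (algebraMap R A)).map π := by
    rw [Ideal.map_map]; rfl
  have hgu : Ideal.span {g} ≤ u := le_sup_right.trans hmin.1.2
  have hgp' : Ideal.span {g} ≤ p := by simpa [Ideal.span_le] using hgp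
  have hmem : ∀ n : Ideal A, Ideal.span {g} ≤ n → ∀ x : A, π x ∈ n.map π ↔ x ∈ n :=
    fun n hn x => by
      rw [← Ideal.mem_comap, Ideal.comap_map_of_surjective _ hπs, ← RingHom.ker_eq_comap_bot,
        hker, sup_eq_left.2 hn]
  have humax : (u.map π).IsMaximal :=
    Ideal.IsMaximal.map_of_surjective_of_ker_le hπs (hker.trans_le hgu)
  have hppr : (p.map π).IsPrime := Ideal.map_isPrime_of_surjective hπs (hker.trans_le hgp')
  have hmin' : u.map π ∈
      ((maximalIdeal R).map (algebraMap R (A ⧸ Ideal.span {g}))).minimalPrimes := by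
    rw [hmap]
    refine ⟨⟨humax.isPrime, Ideal.map_mono (le_sup_left.trans hmin.1.2)⟩, fun n hn hnu => ?_⟩
    have hn1 := hn.1
    have h1 : n.comap π ≤ u := fun x hx => (hmem u hgu x).1 (hnu hx)
    have h2 : (maximalIdeal R).map (algebraMap R A) ⊔ Ideal.span {g} ≤ n.comap π :=
      sup_le (Ideal.map_le_iff_le_comap.1 hn.2)
        (hker.symm.le.trans (Ideal.comap_mono bot_le))
    exact Ideal.map_le_iff_le_comap.2 (hmin.2 ⟨inferInstance, h2⟩ h1)
  obtain ⟨e, he, heu, hen⟩ := exists_isIdempotentElem_of_isolated (R := R) _ hmin'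
  have hep : e ∈ p.map π := hen _ hppr (by rw [hmap]; exact Ideal.map_mono hmp) fun h => hne <|
    Ideal.ext fun x => by rw [← hmem p hgp', h, hmem u hgu]
  obtain ⟨s, rfl⟩ := hπs e
  -- `s` lifts an idempotent modulo `g` that lies in `p` but not in `u`; hence `1 - s ∉ p`, and `s *
  -- (1 - s)` is a multiple of `g`.
  refine ⟨1 - s, s, fun h => ?_, fun h => heu ((hmem u hgu s).2 h), ?_⟩
  · have hs := (hmem p hgp' s).1 hep
    exact hp.ne_top ((Ideal.eq_top_iff_one _).2 (by simpa using p.add_mem h hs))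
  · rw [← Ideal.Quotient.eq_zero_iff_mem, map_mul, map_sub, map_one, mul_sub, mul_one]
    exact sub_eq_zero.2 he.symm

variable {R A K : Type*} [CommRing R] [IsLocalRing R]
    [IsNoetherianRing R] [IsAdicComplete (maximalIdeal R) R] [CommRing A] [IsDomain A] [Algebra R A]
    [Algebra.FiniteType R A] [Field K] [Algebra A K] [FaithfulSMul A K]

/-- Let `W` be the ring of fractions of `A` that are regular at a set `Y` of points of the closed
fiber of a relative curve. Then every point of the closed fiber of `W` specializes to a point
of `Y`. -/
theorem exists_comap_le_of_regular {Y : Set (Ideal A)} (hY : ∀ u ∈ Y, u.IsPrime)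
    (hYm : ∀ u ∈ Y, (maximalIdeal R).map (algebraMap R A) ≤ u)
    (hdim : ∀ p q : Ideal A, p.IsPrime → q.IsPrime →
      (maximalIdeal R).map (algebraMap R A) ≤ p → p < q → q.IsMaximal)
    (hbot : (maximalIdeal R).map (algebraMap R A) ≠ ⊥)
    {W : Type*} [CommRing W] [Algebra A W] [Algebra W K] [IsScalarTower A W K]
    [FaithfulSMul W K]
    (hW : ∀ f : K, (∀ u ∈ Y, ∃ a s : A, s ∉ u ∧ algebraMap A K s * f = algebraMap A K a) →
      ∃ w : W, algebraMap W K w = f)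
    (N : Ideal W) [hN : N.IsPrime]
    (hmN : (maximalIdeal R).map (algebraMap R A) ≤ N.comap (algebraMap A W)) :
    ∃ u ∈ Y, N.comap (algebraMap A W) ≤ u := by
  classical
  by_contra! hcon
  set p := N.comap (algebraMap A W) with hp
  have hpp : p.IsPrime := inferInstance
  set I := (maximalIdeal R).map (algebraMap R A) with hI
  have hNA : IsNoetherianRing A := Algebra.FiniteType.isNoetherianRing R A
  have hfin : I.minimalPrimes.Finite := Ideal.finite_minimalPrimes_of_isNoetherianRing A I
  -- Prime avoidance: `g` is to serve as a denominator, and its zero locus must contain no component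
  -- of the closed fiber other than possibly that of `p`.
  obtain ⟨g, hgp, hg⟩ : ∃ g ∈ p, g ≠ 0 ∧ ∀ n ∈ I.minimalPrimes, n ≠ p → g ∉ n := by
    by_contra! hno
    have hsub : (p : Set A) ⊆ ⋃ n ∈ ((insert ⊥ (hfin.toFinset.erase p) : Finset (Ideal A)) :
        Set (Ideal A)), (n : Set A) := fun g hgp => by
      by_cases h0 : g = 0
      · exact Set.mem_biUnion (x := (⊥ : Ideal A)) (by simp) (by simp [h0])
      · obtain ⟨n, hn, hne, hgn⟩ := hno g hgp h0
        exact Set.mem_biUnion (x := n) (by simp [hn, hne]) hgn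
    obtain ⟨n, hn, hle⟩ := (Ideal.subset_union_prime (f := fun n : Ideal A => n) ⊥ ⊥ (by
      intro n hn _ _
      simp only [Finset.mem_insert, Finset.mem_erase, Set.Finite.mem_toFinset] at hn
      rcases hn with rfl | hn
      · exact Ideal.isPrime_bot
      · exact hn.2.1.1)).1 hsub
    simp only [Finset.mem_insert, Finset.mem_erase, Set.Finite.mem_toFinset] at hn
    rcases hn with rfl | hn
    · exact hbot (le_bot_iff.1 (hmN.trans hle))
    · exact hn.1 (le_antisymm (hn.2.2 ⟨hpp, hmN⟩ hle) hle)
  obtain ⟨hg0, hg⟩ := hg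
  have hiso : ∀ u ∈ Y, g ∈ u → u.IsMaximal ∧ u ∈ (I ⊔ Ideal.span {g}).minimalPrimes := by
    -- A prime below `u` that contains `I` and `g` is not minimal over `I`: it would have to be `p`,
    -- but `p` is not contained in `u`. As the fiber has dimension one, it is maximal and so equals
    -- `u`.
    intro u hu hgu
    have hup := hY u hu
    have aux : ∀ n : Ideal A, n.IsPrime → I ≤ n → g ∈ n → n ≤ u → ∃ n' : Ideal A, n'.IsPrime ∧
        I ≤ n' ∧ n' < n := by
      intro n hn hIn hgn hnu
      obtain ⟨n', hn', hle⟩ := Ideal.exists_minimalPrimes_le hIn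
      refine ⟨n', hn'.1.1, hn'.1.2, lt_of_le_of_ne hle ?_⟩
      rintro rfl
      refine hg n' hn' ?_ hgn
      rintro rfl
      exact hcon u hu hnu
    obtain ⟨n, hn, hIn, hlt⟩ := aux u hup (hYm u hu) hgu le_rfl
    refine ⟨hdim n u hn hup hIn hlt, ⟨hup, sup_le (hYm u hu) (by simpa [Ideal.span_le] using hgu)⟩,
      fun q hq hqu => ?_⟩
    have hq1 := hq.1
    obtain ⟨n', hn', hIn', hlt'⟩ := aux q hq1 (le_sup_left.trans hq.2)
      (hq.2 (Ideal.mem_sup_right (Ideal.mem_span_singleton_self g))) hqu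
    exact ((hdim n' q hn' hq1 hIn' hlt').eq_of_le hup.ne_top hqu).symm.le
  have hYfin : {u ∈ Y | g ∈ u}.Finite :=
    (Ideal.finite_minimalPrimes_of_isNoetherianRing A (I ⊔ Ideal.span {g})).subset
      fun u hu => (hiso u hu.1 hu.2).2
  have hloc : ∀ u, ∃ f s : A, u ∈ Y → g ∈ u → f ∉ p ∧ s ∉ u ∧ s * f ∈ Ideal.span {g} := by
    intro u
    by_cases h : u ∈ Y ∧ g ∈ u
    · obtain ⟨h1, h2⟩ := hiso u h.1 h.2
      obtain ⟨f, s, hfs⟩ := exists_mul_mem_span_of_isolated (R := R) h2 hmN hgp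
        fun e => hcon u h.1 e.le
      exact ⟨f, s, fun _ _ => hfs⟩
    · exact ⟨0, 0, fun h1 h2 => (h ⟨h1, h2⟩).elim⟩
  choose f s hfs using hloc
  let F := ∏ u ∈ hYfin.toFinset, f u
  have hF : F ∉ p := fun h => by
    obtain ⟨u, hu, hup⟩ := (hpp.prod_mem_iff).1 h
    rw [Set.Finite.mem_toFinset] at hu
    exact (hfs u hu.1 hu.2).1 hup
  have hgK : algebraMap A K g ≠ 0 := by
    rwa [Ne, FaithfulSMul.algebraMap_eq_zero_iff]
  -- At the finitely many `u ∈ Y` containing `g`, the factor `f u` of `F` is divisible by `g`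
  -- locally; elsewhere `g` itself is an admissible denominator.
  obtain ⟨w, hw⟩ := hW (algebraMap A K F / algebraMap A K g) fun u hu => by
    by_cases hgu : g ∈ u
    · obtain ⟨-, h2, h3⟩ := hfs u hu hgu
      obtain ⟨c, hc⟩ := Ideal.mem_span_singleton'.1 h3
      refine ⟨c * ∏ v ∈ hYfin.toFinset.erase u, f v, s u, h2, ?_⟩
      have hprod : F = f u * ∏ v ∈ hYfin.toFinset.erase u, f v :=
        (Finset.mul_prod_erase _ _ (hYfin.mem_toFinset.2 ⟨hu, hgu⟩)).symm
      rw [mul_div_assoc', div_eq_iff hgK, ← map_mul, ← map_mul, hprod, ← mul_assoc, ← hc]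
      congr 1; ring
    · exact ⟨F, g, hgu, mul_div_cancel₀ _ hgK⟩
  have : algebraMap A W F = w * algebraMap A W g := by
    apply FaithfulSMul.algebraMap_injective W K
    rw [map_mul, hw, ← IsScalarTower.algebraMap_apply, ← IsScalarTower.algebraMap_apply,
      div_mul_cancel₀ _ hgK]
  exact hF (show algebraMap A W F ∈ N from this ▸ N.mul_mem_left _ hgp)

end Denominators

/-! ### Completion along a finitely generated ideal -/

namespace AdicCompletion

variable {W : Type*} [CommRing W] {I : Ideal W}

/-- For finitely generated `I`, the kernel of evaluation at level `n` is `I ^ n`. -/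
theorem mem_map_pow_iff (hI : I.FG) (n : ℕ) (y : AdicCompletion I W) :
    y ∈ (I.map (algebraMap W (AdicCompletion I W))) ^ n ↔ eval I W n y = 0 := by
  rw [← LinearMap.mem_ker, ← pow_smul_top_eq_ker_eval hI, Ideal.smul_top_eq_map, ← Ideal.map_pow]
  rfl

theorem exists_sub_algebraMap_mem (hI : I.FG) (n : ℕ) (y : AdicCompletion I W) :
    ∃ w : W, y - algebraMap W _ w ∈ (I.map (algebraMap W (AdicCompletion I W))) ^ n := by
  obtain ⟨w, hw⟩ := Submodule.mkQ_surjective _ (eval I W n y)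
  refine ⟨w, ?_⟩
  rw [mem_map_pow_iff hI, map_sub, sub_eq_zero, ← hw]
  exact (eval_of I W n w).symm

theorem algebraMap_mem_map_pow_iff (hI : I.FG) (n : ℕ) (w : W) :
    algebraMap W _ w ∈ (I.map (algebraMap W (AdicCompletion I W))) ^ n ↔ w ∈ I ^ n := by
  rw [mem_map_pow_iff hI]
  have h : eval I W n (algebraMap W (AdicCompletion I W) w) =
    Submodule.mkQ (I ^ n • ⊤ : Submodule W W) w := eval_of I W n w
  rw [h, Submodule.mkQ_apply, Submodule.Quotient.mk_eq_zero, smul_eq_mul, Ideal.mul_top]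

theorem isAdicComplete_map (hI : I.FG) :
    IsAdicComplete (I.map (algebraMap W (AdicCompletion I W))) (AdicCompletion I W) := by
  have h := isAdicComplete (M := W) hI
  exact { haus' := (IsHausdorff.map_algebraMap_iff.2 h.toIsHausdorff).haus'
          prec' := (IsPrecomplete.map_algebraMap_iff.2 h.toIsPrecomplete).prec' }

theorem le_of_isMaximal (hI : I.FG) (Q : Ideal (AdicCompletion I W))
    [hQ : Q.IsMaximal] : I.map (algebraMap W (AdicCompletion I W)) ≤ Q := by
  have := isAdicComplete_map hI
  refine (IsAdicComplete.le_jacobson_bot _).trans ?_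
  rw [Ideal.jacobson_bot]
  exact Ring.jacobson_le_of_isMaximal Q

end AdicCompletion

/-! ### Rings with denominators: Noetherianity and injectivity -/

/-- Elements of `W` are locally fractions of elements of `A` at the points of the zero locus
of `I`. -/
def HasDenominators (A : Type*) {W : Type*} [CommRing A] [CommRing W] [Algebra A W]
    (I : Ideal W) : Prop :=
  ∀ (w : W) (N : Ideal W), N.IsPrime → I ≤ N → ∃ s a : A, algebraMap A W s ∉ N ∧
    algebraMap A W s * w = algebraMap A W a

/-- A ring in which all ideals are extended from a Noetherian ring is Noetherian. -/
theorem isNoetherianRing_of_map_comap {A B : Type*} [CommRing A] [IsNoetherianRing A] [CommRing B]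
    (f : A →+* B) (h : ∀ J : Ideal B, (J.comap f).map f = J) : IsNoetherianRing B :=
  (isNoetherianRing_iff_ideal_fg B).2 fun J => by
    rw [← h J]
    exact ((J.comap f).fg_of_isNoetherianRing).map f

namespace HasDenominators

variable {A W : Type*} [CommRing A] [CommRing W] [Algebra A W] {I : Ideal W}

/-- Membership is tested locally. The extended ideal also contains `I ^ n`, so only maximal ideals
over `I` matter, and there `w` comes from `A` up to a unit. -/
theorem map_comap (h : HasDenominators A I) {I₀ : Ideal A} (hI₀ : I = I₀.map (algebraMap A W))
    {J : Ideal W} {n : ℕ} (hJ : I ^ n ≤ J) :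
    (J.comap (algebraMap A W)).map (algebraMap A W) = J := by
  refine le_antisymm Ideal.map_comap_le fun w hw => ?_
  set J' := (J.comap (algebraMap A W)).map (algebraMap A W) with hJ'
  have hIJ' : I ^ n ≤ J' := by
    rw [hI₀, ← Ideal.map_pow] at hJ ⊢
    exact Ideal.map_mono (Ideal.map_le_iff_le_comap.1 hJ)
  let D : Ideal W := Submodule.comap (LinearMap.mulRight W w) J'
  by_contra hwJ
  have hD : D ≠ ⊤ := fun hD => hwJ (by
    have : (1 : W) ∈ D := hD ▸ trivial
    simpa [D, Submodule.mem_comap] using this)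
  obtain ⟨N, hN, hDN⟩ := Ideal.exists_le_maximal D hD
  have hIN : I ≤ N := by
    refine hN.isPrime.le_of_pow_le (n := n) (le_trans (fun c hc => ?_) hDN)
    exact J'.mul_mem_right w (hIJ' hc)
  obtain ⟨s, a, hs, ha⟩ := h w N hN.isPrime hIN
  refine hs (hDN (show algebraMap A W s * w ∈ J' from ha ▸ Ideal.mem_map_of_mem _ ?_))
  rw [Ideal.mem_comap, ← ha]
  exact J.mul_mem_left _ hw

/-- The completion of a ring with denominators in a Noetherian ring is Noetherian if the ideal is
the radical of a principal ideal. -/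
theorem isNoetherianRing_adicCompletion [IsNoetherianRing A] (h : HasDenominators A I)
    {I₀ : Ideal A} (hI₀ : I = I₀.map (algebraMap A W)) {t : A} (ht : t ∈ I₀)
    (hIt : I₀ ≤ (Ideal.span {t}).radical) : IsNoetherianRing (AdicCompletion I W) := by
  have hI : I.FG := hI₀ ▸ (I₀.fg_of_isNoetherianRing).map _
  let Î := I.map (algebraMap W (AdicCompletion I W))
  have hc : IsAdicComplete Î (AdicCompletion I W) := AdicCompletion.isAdicComplete_map hI
  have hÎ : Î = I₀.map (algebraMap A (AdicCompletion I W)) := by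
    refine (congrArg (Ideal.map (algebraMap W (AdicCompletion I W))) hI₀).trans ?_
    rw [Ideal.map_map]; rfl
  refine isNoetherianRing_of_isAdicComplete (I := Î) (t := algebraMap A _ t) ?_ (hI.map _) ?_ ?_
  · rw [hÎ]; exact Ideal.mem_map_of_mem _ ht
  · rw [hÎ, Ideal.map_le_iff_le_comap]
    intro x hx
    obtain ⟨k, hk⟩ := hIt hx
    refine ⟨k, ?_⟩
    rw [← map_pow]
    obtain ⟨c, hc⟩ := Ideal.mem_span_singleton'.1 hk
    rw [← hc, map_mul]
    exact Ideal.mul_mem_left _ _ (Ideal.mem_span_singleton_self _)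
  · intro J n hJ
    have hJW : I ^ n ≤ J.comap (algebraMap W _) := fun x hx =>
      hJ ((AdicCompletion.algebraMap_mem_map_pow_iff hI n x).2 hx)
    have : J = (((J.comap (algebraMap W _)).comap (algebraMap A W)).map (algebraMap A W)).map
        (algebraMap W _) := by
      -- Since `J` contains the `n`-th power of the extended ideal, it is generated by its trace on
      -- `W`, which is in turn generated by its trace on `A`.
      rw [h.map_comap hI₀ hJW]
      refine le_antisymm (fun y hy => ?_) Ideal.map_comap_le
      obtain ⟨w, hw⟩ := AdicCompletion.exists_sub_algebraMap_mem hI n y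
      have hwJ : algebraMap W _ w ∈ J := by simpa using J.sub_mem hy (hJ hw)
      have h1 : y - algebraMap W _ w ∈ (J.comap (algebraMap W _)).map
          (algebraMap W (AdicCompletion I W)) := by
        rw [← Ideal.map_pow] at hw
        exact Ideal.map_mono hJW hw
      simpa using Ideal.add_mem _ h1 (Ideal.mem_map_of_mem _ (show w ∈ J.comap _ from hwJ))
    rw [this]
    exact ((Ideal.fg_of_isNoetherianRing _).map _).map _

/-- Up to units every element of the localization comes from `A`, so its ideals are extended from
`A`. This makes Artin-Rees available without `W` being Noetherian. -/
theorem isNoetherianRing_localization [IsNoetherianRing A] (h : HasDenominators A I)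
    (N : Ideal W) [hN : N.IsPrime] (hIN : I ≤ N) :
    IsNoetherianRing (Localization.AtPrime N) := by
  refine isNoetherianRing_of_map_comap (algebraMap A _) fun J =>
    le_antisymm Ideal.map_comap_le fun x hx => ?_
  obtain ⟨w, v, rfl⟩ := IsLocalization.exists_mk'_eq N.primeCompl x
  obtain ⟨s, a, hs, ha⟩ := h w N hN hIN
  have hsu : IsUnit (algebraMap W (Localization.AtPrime N) (algebraMap A W s)) :=
    IsLocalization.map_units _ (⟨_, hs⟩ : N.primeCompl)
  have hw : algebraMap W (Localization.AtPrime N) w ∈ J := by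
    rw [← IsLocalization.mk'_spec (Localization.AtPrime N) w v]
    exact J.mul_mem_right _ hx
  have ha' : algebraMap A (Localization.AtPrime N) a ∈
      (J.comap (algebraMap A _)).map (algebraMap A _) := by
    refine Ideal.mem_map_of_mem _ ?_
    rw [Ideal.mem_comap, IsScalarTower.algebraMap_apply A W, ← ha, map_mul]
    exact J.mul_mem_left _ hw
  rw [← Ideal.mul_unit_mem_iff_mem _ (IsLocalization.map_units (Localization.AtPrime N) v),
    IsLocalization.mk'_spec, ← Ideal.unit_mul_mem_iff_mem _ hsu, ← map_mul, ha,
    ← IsScalarTower.algebraMap_apply]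
  exact ha'

/-- An annihilator of a nonzero element of `W` in the completion vanishes locally at each maximal
ideal. -/
theorem algebraMap_eq_zero_of_mul_eq_zero [IsNoetherianRing A] [IsDomain W]
    (h : HasDenominators A I) (hI : I.FG) [IsNoetherianRing (AdicCompletion I W)]
    (Q : Ideal (AdicCompletion I W)) [hQ : Q.IsMaximal] {a : W} (ha : a ≠ 0)
    {c : AdicCompletion I W} {z : AdicCompletion I W} (hz : z ∉ Q)
    (hac : z * (algebraMap W _ a * c) = 0) :
    algebraMap _ (Localization.AtPrime Q) c = 0 := by
  set Î := I.map (algebraMap W (AdicCompletion I W)) with hÎ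
  have hÎQ : Î ≤ Q := AdicCompletion.le_of_isMaximal hI Q
  let N := Q.comap (algebraMap W (AdicCompletion I W))
  have hN : N.IsPrime := inferInstance
  have hIN : I ≤ N := Ideal.map_le_iff_le_comap.1 hÎQ
  let O := Localization.AtPrime N
  have hON : IsNoetherianRing O := h.isNoetherianRing_localization N hIN
  let 𝔬 := I.map (algebraMap W O)
  have hinj : Function.Injective (algebraMap W O) :=
    IsLocalization.injective O N.primeCompl_le_nonZeroDivisors
  have hOd : IsDomain O := IsLocalization.isDomain_localization N.primeCompl_le_nonZeroDivisors
  -- Artin-Rees: for all `n`, multiples of `a` in `𝔬 ^ (n + k)` lie in `𝔬 ^ n * (a)`, and `a` can be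
  -- cancelled in the domain `O`.
  obtain ⟨k, hk⟩ := 𝔬.exists_pow_inf_eq_pow_smul (Ideal.span {algebraMap W O a})
  let T := Localization.AtPrime Q
  have key : ∀ n, algebraMap _ T c ∈ (Î.map (algebraMap _ T)) ^ n := by
    intro n
    -- The summand `k` is what Artin-Rees loses; the `1` keeps the exponent positive, so that `v`
    -- agrees with `z` modulo `Q`.
    obtain ⟨w, hw⟩ := AdicCompletion.exists_sub_algebraMap_mem hI (n + k + 1) c
    obtain ⟨v, hv⟩ := AdicCompletion.exists_sub_algebraMap_mem hI (n + k + 1) z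
    have hvN : v ∉ N := fun hvN => by
      exact hz (by simpa using Q.add_mem (hÎQ (Ideal.pow_le_self (by omega) hv)) hvN)
    have haw : v * (a * w) ∈ I ^ (n + k + 1) := by
      rw [← AdicCompletion.algebraMap_mem_map_pow_iff hI, map_mul, map_mul]
      have : algebraMap W _ v * (algebraMap W _ a * algebraMap W _ w) =
        z * (algebraMap W (AdicCompletion I W) a * c) - (z - algebraMap W _ v) *
          (algebraMap W _ a * c) - algebraMap W _ v * (algebraMap W _ a) *
            (c - algebraMap W _ w) := by ring
      rw [this, hac, zero_sub]
      exact Ideal.sub_mem _ (Ideal.neg_mem_iff _ |>.2 (Ideal.mul_mem_right _ _ hv))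
        (Ideal.mul_mem_left _ _ hw)
    have hawO : algebraMap W O a * algebraMap W O w ∈ 𝔬 ^ (n + k) := by
      refine Ideal.pow_le_pow_right (Nat.le_succ _) ?_
      rw [← Ideal.map_pow, ← map_mul, IsLocalization.algebraMap_mem_map_algebraMap_iff N.primeCompl]
      exact ⟨v, hvN, haw⟩
    have hmem : algebraMap W O a * algebraMap W O w ∈ 𝔬 ^ n * Ideal.span {algebraMap W O a} := by
      have h1 := hk (n + k) (by omega)
      rw [Nat.add_sub_cancel, smul_eq_mul, Ideal.mul_top, smul_eq_mul, smul_eq_mul] at h1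
      exact Ideal.mul_mono_right inf_le_right (h1.le ⟨hawO, Ideal.mul_mem_right _ _
        (Ideal.mem_span_singleton_self _)⟩)
    obtain ⟨y, hy, hya⟩ := Ideal.mem_mul_span_singleton.1 hmem
    have hwy : algebraMap W O w ∈ 𝔬 ^ n := by
      have : y = algebraMap W O w := by
        rw [mul_comm] at hya
        exact mul_left_cancel₀ (fun h0 => ha (hinj (h0.trans (map_zero _).symm))) hya
      rwa [← this]
    rw [← Ideal.map_pow, IsLocalization.algebraMap_mem_map_algebraMap_iff N.primeCompl] at hwy
    obtain ⟨v', hv', hvw⟩ := hwy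
    rw [← Ideal.map_pow, IsLocalization.algebraMap_mem_map_algebraMap_iff Q.primeCompl]
    refine ⟨algebraMap W _ v', hv', ?_⟩
    have h1 := (AdicCompletion.algebraMap_mem_map_pow_iff hI n _).2 hvw
    have h2 := Ideal.mul_mem_left _ (algebraMap W _ v')
      (Ideal.pow_le_pow_right (by omega : n ≤ n + k + 1) hw)
    rw [map_mul] at h1
    simpa [mul_sub] using Ideal.add_mem _ h2 h1
  have hne : Î.map (algebraMap _ T) ≠ ⊤ := by
    rw [IsLocalization.map_algebraMap_ne_top_iff_disjoint Q.primeCompl]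
    exact Set.disjoint_left.2 fun x hx hxI => hx (hÎQ hxI)
  have := Ideal.iInf_pow_eq_bot_of_isLocalRing _ hne
  rw [← Ideal.mem_bot, ← this, Ideal.mem_iInf]
  exact key

/-- Minimal primes of the completion contract to zero. -/
theorem eq_zero_of_algebraMap_mem_minimalPrimes [IsNoetherianRing A] [IsDomain W]
    (h : HasDenominators A I) (hI : I.FG) [IsNoetherianRing (AdicCompletion I W)]
    {P Q : Ideal (AdicCompletion I W)} [hQ : Q.IsMaximal] (hP : P ∈ minimalPrimes _)
    (hPQ : P ≤ Q) {a : W} (ha : algebraMap W _ a ∈ P) : a = 0 := by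
  by_contra ha0
  let T := Localization.AtPrime Q
  have hPT : P.map (algebraMap _ T) ∈ (⊥ : Ideal T).minimalPrimes := by
    have h1 := IsLocalization.minimalPrimes_map Q.primeCompl T (⊥ : Ideal (AdicCompletion I W))
    rw [Ideal.map_bot] at h1
    rw [h1, Set.mem_preimage, IsLocalization.under_map_of_isPrime_disjoint
      Q.primeCompl T hP.isPrime (Set.disjoint_left.2 fun x hx hxP => hx (hPQ hxP))]
    simpa using hP
  -- Elements of a minimal prime are zero divisors, whereas `a` is not one in `T`.
  obtain ⟨y, hy0, hy⟩ := Ideal.exists_mul_mem_of_mem_minimalPrimes (I := ⊥) hPT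
    (Ideal.mem_map_of_mem _ ha)
  obtain ⟨c, s, rfl⟩ := IsLocalization.exists_mk'_eq Q.primeCompl y
  rw [Ideal.mem_bot, ← IsLocalization.mk'_one (M := Q.primeCompl) T, ← IsLocalization.mk'_mul,
    IsLocalization.mk'_eq_zero_iff] at hy
  obtain ⟨z, hz⟩ := hy
  refine hy0 ?_
  rw [Ideal.mem_bot, IsLocalization.mk'_eq_zero_iff]
  have h1 := h.algebraMap_eq_zero_of_mul_eq_zero hI Q ha0 z.2 hz
  rwa [IsLocalization.map_eq_zero_iff Q.primeCompl] at h1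

end HasDenominators

/-! ### Approximating elements of a local domain up to units -/

section Weierstrass

open IsLocalRing

variable {R B : Type*} [CommRing R] [IsLocalRing R]
  [IsAdicComplete (maximalIdeal R) R] [CommRing B] [IsLocalRing B] [IsNoetherianRing B]
  [Algebra R B]

/-- A quotient of a Noetherian local algebra over a complete local ring is finite if its closed
fiber is. -/
theorem Ideal.finite_quotient_of_finite_quotient_sup {𝔠 : Ideal B}
    (hB : (maximalIdeal R).map (algebraMap R B) ≠ ⊤)
    [Module.Finite R (B ⧸ (𝔠 ⊔ (maximalIdeal R).map (algebraMap R B)))] :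
    Module.Finite R (B ⧸ 𝔠) := by
  set m := maximalIdeal R with hm
  have h1 : IsHausdorff (m.map (algebraMap R B)) (B ⧸ 𝔠) := IsHausdorff.of_isLocalRing _ _ hB
  have h2 : IsHausdorff m (B ⧸ 𝔠) := IsHausdorff.map_algebraMap_iff.1 h1
  obtain ⟨s, hs⟩ := Module.Finite.fg_top (R := R) (M := B ⧸ (𝔠 ⊔ m.map (algebraMap R B)))
  choose g hg using Ideal.Quotient.mk_surjective (I := 𝔠 ⊔ m.map (algebraMap R B))
  let π : B →ₗ[R] B ⧸ 𝔠 := (Ideal.Quotient.mkₐ R 𝔠).toLinearMap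
  let π' : B →ₗ[R] B ⧸ (𝔠 ⊔ m.map (algebraMap R B)) := (Ideal.Quotient.mkₐ R _).toLinearMap
  have hspan : Submodule.map π' (Submodule.span R (g '' s)) = ⊤ := by
    rw [Submodule.map_span, ← Set.image_comp, ← hs]
    congr 1
    ext x
    simp only [Set.mem_image, Function.comp_apply]
    exact ⟨fun ⟨y, hy, e⟩ => by rw [← e]; exact (hg y).symm ▸ hy, fun hx => ⟨x, hx, hg x⟩⟩
  refine ⟨Submodule.fg_def.2 ⟨π '' (g '' s), (s.finite_toSet.image g).image π, ?_⟩⟩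
  refine Submodule.span_eq_top_of_isPrecomplete (I := m) ((s.finite_toSet.image g).image π)
    (top_le_iff.1 fun z _ => ?_)
  obtain ⟨y, rfl⟩ := Ideal.Quotient.mk_surjective z
  obtain ⟨r, hr, hry⟩ := Submodule.mem_map.1 (hspan.symm ▸ Submodule.mem_top :
    π' y ∈ Submodule.map π' (Submodule.span R (g '' s)))
  have hry' : Ideal.Quotient.mk (𝔠 ⊔ m.map (algebraMap R B)) y = Ideal.Quotient.mk _ r := hry.symm
  obtain ⟨c, hc, i, hi, hci⟩ := Submodule.mem_sup.1 (Ideal.Quotient.eq.1 hry')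
  have hi' : i ∈ (m • ⊤ : Submodule R B) := by rw [Ideal.smul_top_eq_map]; exact hi
  have hy : Ideal.Quotient.mk 𝔠 y = π r + π i := by
    change _ = Ideal.Quotient.mk 𝔠 r + Ideal.Quotient.mk 𝔠 i
    rw [← map_add, Ideal.Quotient.eq]
    convert hc using 1
    linear_combination -hci
  rw [hy, ← Submodule.map_span]
  refine Submodule.add_mem_sup (Submodule.mem_map_of_mem hr) ?_
  have := Submodule.mem_map_of_mem (f := π) hi'
  rw [Submodule.map_smul''] at this
  exact Submodule.smul_mono le_rfl le_top this

/-- Let `B` be a Noetherian local domain over a complete local ring and `O` a dense subalgebra. If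
`B` is finite modulo all nonzero ideals without `t`-torsion then, up to units, every element of `B`
lies in `O`. -/
theorem exists_mem_associated_of_dense [IsNoetherianRing R] [IsDomain B] (O : Subalgebra R B)
    {t : R}
    (ht : maximalIdeal R ≤ (Ideal.span {t}).radical)
    (hB : (maximalIdeal R).map (algebraMap R B) ≠ ⊤)
    (hO : ∀ (y : B) (n : ℕ), ∃ o ∈ O, y - o ∈ ((maximalIdeal R).map (algebraMap R B)) ^ n)
    (hfin : ∀ 𝔠 : Ideal B, 𝔠 ≠ ⊥ → (∀ x, algebraMap R B t * x ∈ 𝔠 → x ∈ 𝔠) →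
      Module.Finite R (B ⧸ (𝔠 ⊔ (maximalIdeal R).map (algebraMap R B)))) (b : B) :
    ∃ o ∈ O, ∃ u : Bˣ, b = o * u := by
  by_cases hb : b = 0
  · exact ⟨0, O.zero_mem, 1, by simp [hb]⟩
  set m := maximalIdeal R with hm
  set mB := m.map (algebraMap R B) with hmB
  set τ := algebraMap R B t with hτ
  let 𝔟 : Ideal B := Ideal.span {b}
  -- The chain of ideals `(𝔟 : τ ^ n)`; its stable value is the `τ`-saturation of `𝔟`, to which
  -- `hfin` applies.
  let F : ℕ →o Ideal B := ⟨fun n => Submodule.comap (LinearMap.mulLeft B (τ ^ n)) 𝔟,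
    monotone_nat_of_le_succ fun n x hx => by
      change τ ^ (n + 1) * x ∈ 𝔟
      rw [pow_succ', mul_assoc]
      exact 𝔟.mul_mem_left _ hx⟩
  obtain ⟨n, hn⟩ := monotone_stabilizes_iff_noetherian.2 (inferInstance : IsNoetherian B B) F
  have hmemF : ∀ k x, x ∈ F k ↔ τ ^ k * x ∈ 𝔟 := fun k x => Iff.rfl
  have hF : F n ≠ ⊥ := fun h => hb <| by
    have : b ∈ F n := 𝔟.mul_mem_left _ (Ideal.mem_span_singleton_self b)
    rwa [h] at this
  have hsat : ∀ x, τ * x ∈ F n → x ∈ F n := fun x hx => by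
    rw [hn (n + 1) (Nat.le_succ n), hmemF, pow_succ, mul_assoc]
    exact hx
  have h1 := hfin (F n) hF hsat
  have h2 : Module.Finite R (B ⧸ F n) := Ideal.finite_quotient_of_finite_quotient_sup hB
  let π : B →ₗ[R] B ⧸ F n := (Ideal.Quotient.mkₐ R (F n)).toLinearMap
  have hmap : (m • ⊤ : Submodule R B).map π ≤ m • ⊤ := by
    rw [Submodule.map_smul'']
    exact Submodule.smul_mono le_rfl le_top
  have hOsat : ∀ y, ∃ o ∈ O, y - o ∈ F n := by
    have : (⊤ : Submodule R (B ⧸ F n)) ≤ (Subalgebra.toSubmodule O).map π := by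
      refine Submodule.le_of_le_smul_of_le_jacobson_bot Module.Finite.fg_top
        (maximalIdeal_le_jacobson ⊥) fun z _ => ?_
      obtain ⟨y, rfl⟩ := Ideal.Quotient.mk_surjective z
      obtain ⟨o, ho, hyo⟩ := hO y 1
      have : Ideal.Quotient.mk (F n) y = π o + π (y - o) := by
        rw [← map_add]; exact congrArg (Ideal.Quotient.mk (F n)) (by ring)
      rw [this]
      refine Submodule.add_mem_sup (Submodule.mem_map_of_mem ho)
        (hmap (Submodule.mem_map_of_mem ?_))
      rw [Ideal.smul_top_eq_map]
      rwa [pow_one] at hyo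
    intro y
    obtain ⟨o, ho, hoy⟩ := Submodule.mem_map.1 (this (trivial : π y ∈ _))
    exact ⟨o, ho, Ideal.Quotient.eq.1 hoy.symm⟩
  have hτO : ∀ k, τ ^ k ∈ O := fun k => O.pow_mem (O.algebraMap_mem t) k
  obtain ⟨k, hk⟩ := Ideal.exists_pow_le_of_le_radical_of_fg ht m.fg_of_isNoetherianRing
  have hmk : mB ^ (k * n) ≤ Ideal.span {τ ^ n} := by
    rw [pow_mul, ← Ideal.span_singleton_pow]
    refine Ideal.pow_right_mono ?_ n
    rw [hmB, ← Ideal.map_pow, Ideal.map_le_iff_le_comap]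
    refine hk.trans ((Ideal.span_singleton_le_iff_mem _).2 ?_)
    exact Ideal.mem_span_singleton_self τ
  -- Precision `k * n` makes the error a multiple `τ ^ n * z`. Approximating `z` modulo `F n = (𝔟 :
  -- τ ^ n)` then corrects it modulo `𝔟`.
  have hOb : ∀ y, ∃ o ∈ O, y - o ∈ 𝔟 := fun y => by
    obtain ⟨o, ho, hyo⟩ := hO y (k * n)
    obtain ⟨z, hz⟩ := Ideal.mem_span_singleton'.1 (hmk hyo)
    obtain ⟨o', ho', hzo⟩ := hOsat z
    refine ⟨o + τ ^ n * o', O.add_mem ho (O.mul_mem (hτO n) ho'), ?_⟩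
    have : y - (o + τ ^ n * o') = τ ^ n * (z - o') := by linear_combination -hz
    rw [this]
    exact hzo
  let J : Ideal B := Ideal.span {o | o ∈ O ∧ o ∈ 𝔟}
  have hmO : ∀ i ∈ mB, ∃ o ∈ O, i - o ∈ mB * 𝔟 := fun i hi => by
    have hi' : i ∈ (m • ⊤ : Submodule R B) := by rw [Ideal.smul_top_eq_map]; exact hi
    refine Submodule.smul_induction_on (p := fun i => ∃ o ∈ O, i - o ∈ mB * 𝔟) hi' ?_ ?_
    · intro r hr y _
      obtain ⟨o, ho, hyo⟩ := hOb y
      refine ⟨r • o, O.smul_mem ho r, ?_⟩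
      rw [← smul_sub, Algebra.smul_def]
      exact Ideal.mul_mem_mul (Ideal.mem_map_of_mem _ hr) hyo
    · rintro x y ⟨o, ho, hx⟩ ⟨o', ho', hy⟩
      refine ⟨o + o', O.add_mem ho ho', ?_⟩
      rw [add_sub_add_comm]
      exact Ideal.add_mem _ hx hy
  -- By `hmO` the error of approximating an element of `𝔟` can be pushed into `mB * 𝔟`. Thus `𝔟 ≤ J
  -- + mB * 𝔟`, and Nakayama applies.
  have h𝔟J : 𝔟 ≤ J := by
    refine Submodule.le_of_le_smul_of_le_jacobson_bot (I := mB) (Ideal.fg_of_isNoetherianRing _)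
      ((le_maximalIdeal hB).trans (maximalIdeal_le_jacobson _)) fun x hx => ?_
    obtain ⟨o, ho, hxo⟩ := hO x 1
    rw [pow_one] at hxo
    obtain ⟨o', ho', hoo⟩ := hmO _ hxo
    have hb' : o + o' ∈ 𝔟 := by
      have := 𝔟.sub_mem hx ((Ideal.mul_le_right : mB * 𝔟 ≤ 𝔟) hoo)
      convert this using 1
      ring
    have : x = (o + o') + (x - o - o') := by ring
    rw [this]
    exact Submodule.add_mem_sup (Ideal.subset_span ⟨O.add_mem ho ho', hb'⟩) hoo
  by_contra! hcon
  -- If no element of `O ∩ 𝔟` is a unit times `b`, each is a nonunit times `b`, and Nakayama would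
  -- force `𝔟 = ⊥`.
  have hJm : J ≤ maximalIdeal B • 𝔟 := Ideal.span_le.2 fun o ⟨ho, hob⟩ => by
    obtain ⟨c, hc⟩ := Ideal.mem_span_singleton'.1 hob
    have hcm : c ∈ maximalIdeal B := by
      by_contra hcu
      rw [mem_maximalIdeal, mem_nonunits_iff, not_not] at hcu
      refine hcon o ho hcu.unit⁻¹ ?_
      rw [← hc, mul_comm c, mul_assoc, IsUnit.mul_val_inv, mul_one]
    rw [← hc]
    exact Submodule.smul_mem_smul hcm (Ideal.mem_span_singleton_self b)
  have : 𝔟 = ⊥ := Submodule.eq_bot_of_le_smul_of_le_jacobson_bot _ _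
    (Ideal.fg_of_isNoetherianRing _) (h𝔟J.trans hJm) (maximalIdeal_le_jacobson _)
  exact hb (Ideal.span_singleton_eq_bot.1 this)

end Weierstrass

/-! ### Finiteness from the one-dimensional closed fiber -/

section OneDimensionalFiber

open IsLocalRing

variable {R A B : Type*} [CommRing R] [IsLocalRing R]
  [CommRing A] [CommRing B] [Algebra R B] [Algebra A B]

/-- Points of the closed fiber of `B` are determined by their images in the spectrum of `A` if
elements of `B` are fractions of elements of `A` modulo the maximal ideal of `R`. -/
theorem le_of_comap_le {q q' : Ideal B} (hq : (maximalIdeal R).map (algebraMap R B) ≤ q)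
    (hq' : (maximalIdeal R).map (algebraMap R B) ≤ q')
    (hA : ∀ y : B, ∃ s a : A, IsUnit (algebraMap A B s) ∧
      algebraMap A B s * y - algebraMap A B a ∈ (maximalIdeal R).map (algebraMap R B))
    (h : q.comap (algebraMap A B) ≤ q'.comap (algebraMap A B)) : q ≤ q' := fun y hy => by
  obtain ⟨s, a, hs, hsa⟩ := hA y
  have h1 : algebraMap A B a ∈ q := by
    simpa using q.sub_mem (q.mul_mem_left (algebraMap A B s) hy) (hq hsa)
  have h2 : algebraMap A B a ∈ q' := h h1
  have h3 : algebraMap A B s * y ∈ q' := by simpa using q'.add_mem (hq' hsa) h2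
  exact (Ideal.unit_mul_mem_iff_mem q' hs).1 h3

variable [Algebra R A] [IsScalarTower R A B]

/-- An Artinian quotient of a local algebra killed by the maximal ideal of the base is finite if it
is locally of finite type. -/
theorem finite_quotient_of_isArtinianRing [IsLocalRing B] [Algebra.FiniteType R A]
    (hA : ∀ y : B, ∃ s a : A, IsUnit (algebraMap A B s) ∧
      algebraMap A B s * y - algebraMap A B a ∈ (maximalIdeal R).map (algebraMap R B))
    (hmax : ((maximalIdeal B).comap (algebraMap A B)).IsMaximal) {𝔡 : Ideal B}
    (h𝔡 : (maximalIdeal R).map (algebraMap R B) ≤ 𝔡) (h𝔡' : 𝔡 ≠ ⊤) [IsArtinianRing (B ⧸ 𝔡)] :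
    Module.Finite R (B ⧸ 𝔡) := by
  set p := (maximalIdeal B).comap (algebraMap A B) with hp
  have hnt : Nontrivial (B ⧸ 𝔡) := Ideal.Quotient.nontrivial_iff.2 h𝔡'
  have hloc : IsLocalRing (B ⧸ 𝔡) := .of_surjective' _ Ideal.Quotient.mk_surjective
  have hnil : IsNilpotent (maximalIdeal (B ⧸ 𝔡)) :=
    (isArtinianRing_iff_isNilpotent_maximalIdeal _).1 inferInstance
  obtain ⟨k, hk⟩ := hnil
  let φ : A →ₐ[R] B ⧸ 𝔡 := (Ideal.Quotient.mkₐ R 𝔡).comp (IsScalarTower.toAlgHom R A B)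
  have hφ : ∀ a, φ a = Ideal.Quotient.mk 𝔡 (algebraMap A B a) := fun a => rfl
  have hsurj : Function.Surjective φ := fun z => by
    obtain ⟨y, rfl⟩ := Ideal.Quotient.mk_surjective z
    obtain ⟨s, a, hs, hsa⟩ := hA y
    have hsp : s ∉ p := fun h => (mem_maximalIdeal _).1 h hs
    obtain ⟨s', hs'⟩ := Ideal.Quotient.exists_inv (I := p) (a := Ideal.Quotient.mk p s)
      (by rwa [Ne, Ideal.Quotient.eq_zero_iff_mem])
    obtain ⟨s', rfl⟩ := Ideal.Quotient.mk_surjective s'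
    have hc : 1 - s * s' ∈ p := by
      rw [← Ideal.Quotient.eq_zero_iff_mem, map_sub, map_mul, hs', map_one, sub_self]
    have hcn : φ (1 - s * s') ^ k = 0 := by
      have h1 : φ (1 - s * s') ∈ maximalIdeal (B ⧸ 𝔡) := by
        rw [mem_maximalIdeal, mem_nonunits_iff, hφ]
        have := IsLocalHom.of_surjective (Ideal.Quotient.mk 𝔡) Ideal.Quotient.mk_surjective
        rw [isUnit_map_iff]
        exact (mem_maximalIdeal _).1 hc
      have := Ideal.pow_mem_pow h1 k
      rwa [hk] at this
    -- `1 - s * s'` is nilpotent in `B ⧸ 𝔡`, so the geometric series inverts `s * s'` within the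
    -- image of `A`.
    refine ⟨s' * (∑ i ∈ Finset.range k, (1 - s * s') ^ i) * a, ?_⟩
    have hinv : φ (s' * ∑ i ∈ Finset.range k, (1 - s * s') ^ i) * φ s = 1 := by
      rw [← map_mul]
      have := mul_neg_geom_sum (1 - s * s') k
      rw [sub_sub_cancel] at this
      rw [show s' * (∑ i ∈ Finset.range k, (1 - s * s') ^ i) * s =
        s * s' * ∑ i ∈ Finset.range k, (1 - s * s') ^ i by ring, this, map_sub, map_one, map_pow,
        hcn, sub_zero]
    have hsy : φ s * Ideal.Quotient.mk 𝔡 y = φ a := by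
      rw [hφ, hφ, ← map_mul, Ideal.Quotient.eq]
      exact h𝔡 hsa
    rw [map_mul, ← hsy, ← mul_assoc, hinv, one_mul]
  have hft : Algebra.FiniteType R (B ⧸ 𝔡) := .of_surjective φ hsurj
  let k := R ⧸ maximalIdeal R
  let _ : Field k := Ideal.Quotient.field _
  let _ : Algebra k (B ⧸ 𝔡) :=
    Ideal.Quotient.algebraQuotientOfLEComap (Ideal.map_le_iff_le_comap.1 h𝔡)
  have htower : IsScalarTower R k (B ⧸ 𝔡) := .of_algebraMap_eq fun r => rfl
  have hft' : Algebra.FiniteType k (B ⧸ 𝔡) := .of_restrictScalars_finiteType R k _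
  have hfin : Module.Finite k (B ⧸ 𝔡) := (Module.finite_iff_isArtinianRing k _).2 inferInstance
  exact Module.Finite.trans k _

/-- If the closed fiber of `A` over `R` is one-dimensional and `B` is a Noetherian local domain
approximated by fractions of elements of `A`, then quotients of `B` by nonzero ideals without
`t`-torsion have finite closed fibers. -/
theorem finite_quotient_of_torsionFree [IsLocalRing B] [IsDomain B] [IsNoetherianRing B]
    [Algebra.FiniteType R A] {t : R} (htm : t ∈ maximalIdeal R)
    (ht : maximalIdeal R ≤ (Ideal.span {t}).radical)
    (hdim : ∀ p q : Ideal A, p.IsPrime → q.IsPrime →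
      (maximalIdeal R).map (algebraMap R A) ≤ p → p < q → q.IsMaximal)
    (hA : ∀ y : B, ∃ s a : A, IsUnit (algebraMap A B s) ∧
      algebraMap A B s * y - algebraMap A B a ∈ (maximalIdeal R).map (algebraMap R B))
    {𝔠 : Ideal B} (h𝔠 : 𝔠 ≠ ⊥) (hsat : ∀ x, algebraMap R B t * x ∈ 𝔠 → x ∈ 𝔠) :
    Module.Finite R (B ⧸ (𝔠 ⊔ (maximalIdeal R).map (algebraMap R B))) := by
  set mB := (maximalIdeal R).map (algebraMap R B) with hmB
  set τ := algebraMap R B t with hτ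
  by_cases htop : 𝔠 ⊔ mB = ⊤
  · have : Subsingleton (B ⧸ (𝔠 ⊔ mB)) := Ideal.Quotient.subsingleton_iff.2 htop
    infer_instance
  have hmap : ∀ q : Ideal B, mB ≤ q →
      (maximalIdeal R).map (algebraMap R A) ≤ q.comap (algebraMap A B) := fun q hq => by
    rw [Ideal.map_le_iff_le_comap, Ideal.comap_comap, ← IsScalarTower.algebraMap_eq]
    exact Ideal.map_le_iff_le_comap.1 hq
  have key : ∀ q : Ideal B, q.IsPrime → 𝔠 ⊔ mB ≤ q →
      q = maximalIdeal B ∧ (q.comap (algebraMap A B)).IsMaximal := fun q hq hle => by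
    have hmq : mB ≤ q := le_sup_right.trans hle
    have hτq : τ ∈ q := hmq (Ideal.mem_map_of_mem _ htm)
    obtain ⟨q₀, hq₀, hq₀q⟩ := Ideal.exists_minimalPrimes_le (le_sup_left.trans hle)
    have hq₀p := hq₀.isPrime
    -- Elements of a minimal prime over `𝔠` are zero divisors modulo `𝔠`, while `τ` is not one.
    have hτq₀ : τ ∉ q₀ := fun h => by
      obtain ⟨y, hy, hty⟩ := Ideal.exists_mul_mem_of_mem_minimalPrimes hq₀ h
      exact hy (hsat y hty)
    have hlt : q₀ < q := lt_of_le_of_ne hq₀q fun h => hτq₀ (h ▸ hτq)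
    have hbot : (⊥ : Ideal B) < q₀ := bot_lt_iff_ne_bot.2 fun h => h𝔠 (le_bot_iff.1 (h ▸ hq₀.le))
    -- The chain `⊥ < q₀ < q` gives `q` height at least two, so the principal ideal theorem yields a
    -- prime `q' < q` over `τ`. Both lie in the closed fiber, and their traces on `A` form a strict
    -- chain.
    have hnot : q ∉ (Ideal.span {τ}).minimalPrimes := fun hqm => by
      have h1 := Ideal.height_le_one_of_isPrincipal_of_mem_minimalPrimes (Ideal.span {τ}) q hqm
      have h2 := Ideal.height_strict_mono_of_isPrime_of_isPrime hlt
      have h3 := Ideal.height_strict_mono_of_isPrime_of_isPrime hbot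
      have h4 : q₀.height < 1 := h2.trans_le h1
      rw [Order.lt_one_iff] at h4
      rw [h4] at h3
      exact not_lt_zero h3
    obtain ⟨q', hq', hq'q⟩ := Ideal.exists_minimalPrimes_le
      ((Ideal.span_singleton_le_iff_mem (I := q)).2 hτq)
    have hq'p := hq'.isPrime
    have hmq' : mB ≤ q' := by
      rw [hmB, Ideal.map_le_iff_le_comap]
      refine ht.trans (((hq'p.comap (algebraMap R B)).radical_le_iff).2 ?_)
      rw [Ideal.span_singleton_le_iff_mem]
      exact hq'.le (Ideal.mem_span_singleton_self τ)
    have hlt' : q'.comap (algebraMap A B) < q.comap (algebraMap A B) :=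
      lt_of_le_not_ge (Ideal.comap_mono hq'q) fun h =>
        hnot (le_antisymm hq'q (le_of_comap_le hmq hmq' hA h) ▸ hq')
    have hmax := hdim _ _ (hq'p.comap _) (hq.comap _) (hmap q' hmq') hlt'
    refine ⟨?_, hmax⟩
    have hqm : q ≤ maximalIdeal B := le_maximalIdeal hq.ne_top
    refine le_antisymm hqm (le_of_comap_le (hmq.trans hqm) hmq hA ?_)
    exact (hmax.eq_of_le ((maximalIdeal.isMaximal B).isPrime.comap _).ne_top
      (Ideal.comap_mono hqm)).symm.le
  obtain ⟨q, hq, hqle⟩ := Ideal.exists_le_maximal _ htop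
  obtain ⟨rfl, hmax⟩ := key q hq.isPrime hqle
  have hart : IsArtinianRing (B ⧸ (𝔠 ⊔ mB)) := by
    rw [isArtinianRing_iff_isNoetherianRing_krullDimLE_zero]
    refine ⟨inferInstance, Ring.KrullDimLE.mk₀ fun J hJ => ?_⟩
    have h1 := (key (J.comap (Ideal.Quotient.mk (𝔠 ⊔ mB))) inferInstance
      (Ideal.mk_ker (I := 𝔠 ⊔ mB).symm.le.trans (Ideal.comap_mono bot_le))).1
    have h2 : (J.comap (Ideal.Quotient.mk (𝔠 ⊔ mB))).IsMaximal := h1 ▸ hq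
    have := Ideal.IsMaximal.map_of_surjective_of_ker_le (f := Ideal.Quotient.mk (𝔠 ⊔ mB))
      (m := J.comap (Ideal.Quotient.mk _))
      Ideal.Quotient.mk_surjective (Ideal.comap_mono bot_le)
    rwa [Ideal.map_comap_of_surjective _ Ideal.Quotient.mk_surjective] at this
  exact finite_quotient_of_isArtinianRing hA hmax le_sup_right htop

end OneDimensionalFiber

/-! ### The Weierstrass property for the localized quotients of the completion -/

open IsLocalRing

/-- If fractions of elements of `A` are dense in `B`, then every element of `B` is associated to
an element of `A`. -/
theorem exists_algebraMap_mul_unit_of_dense {R A B : Type*} [CommRing R] [IsLocalRing R]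
    [IsNoetherianRing R] [IsAdicComplete (maximalIdeal R) R] [CommRing A] [CommRing B]
    [Algebra R A] [Algebra R B] [Algebra A B] [IsScalarTower R A B] [Algebra.FiniteType R A]
    [IsLocalRing B] [IsDomain B] [IsNoetherianRing B] {t : R} (htm : t ∈ maximalIdeal R)
    (ht : maximalIdeal R ≤ (Ideal.span {t}).radical)
    (hdim : ∀ p q : Ideal A, p.IsPrime → q.IsPrime →
      (maximalIdeal R).map (algebraMap R A) ≤ p → p < q → q.IsMaximal)
    (hB : (maximalIdeal R).map (algebraMap R B) ≠ ⊤)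
    (hA : ∀ (y : B) (n : ℕ), ∃ s a : A, IsUnit (algebraMap A B s) ∧
      algebraMap A B s * y - algebraMap A B a ∈ ((maximalIdeal R).map (algebraMap R B)) ^ n)
    (b : B) : ∃ (a : A) (u : Bˣ), b = algebraMap A B a * u := by
  let O : Subalgebra R B :=
    { carrier := {y | ∃ s a : A, IsUnit (algebraMap A B s) ∧
        algebraMap A B s * y = algebraMap A B a}
      mul_mem' := by
        rintro x y ⟨s, a, hs, hx⟩ ⟨s', a', hs', hy⟩
        refine ⟨s * s', a * a', by rw [map_mul]; exact hs.mul hs', ?_⟩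
        rw [map_mul, map_mul, ← hx, ← hy]
        ring
      add_mem' := by
        rintro x y ⟨s, a, hs, hx⟩ ⟨s', a', hs', hy⟩
        refine ⟨s * s', a * s' + a' * s, by rw [map_mul]; exact hs.mul hs', ?_⟩
        rw [map_mul, map_add, map_mul, map_mul, ← hx, ← hy]
        ring
      algebraMap_mem' := fun r => ⟨1, algebraMap R A r, by simp, by
        rw [map_one, one_mul, ← IsScalarTower.algebraMap_apply]⟩ }
  have hO : ∀ (y : B) (n : ℕ), ∃ o ∈ O, y - o ∈ ((maximalIdeal R).map (algebraMap R B)) ^ n := by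
    intro y n
    obtain ⟨s, a, hs, h⟩ := hA y n
    obtain ⟨v, hv⟩ := hs
    refine ⟨↑v⁻¹ * algebraMap A B a, ⟨s, a, ⟨v, hv⟩, by rw [← hv, Units.mul_inv_cancel_left]⟩, ?_⟩
    have := Ideal.mul_mem_left _ (↑v⁻¹ : B) h
    rwa [← hv, mul_sub, Units.inv_mul_cancel_left] at this
  obtain ⟨o, ⟨s, a, ⟨v, hv⟩, hsa⟩, u, rfl⟩ := exists_mem_associated_of_dense O ht hB hO
    (fun 𝔠 h𝔠 hsat => finite_quotient_of_torsionFree htm ht hdim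
      (fun y => by simpa only [pow_one] using hA y 1) h𝔠 hsat) b
  refine ⟨a, v⁻¹ * u, ?_⟩
  rw [← hsa, ← hv, Units.val_mul]
  linear_combination (-(o * u)) * v.mul_inv

namespace HasDenominators

variable {R A W B : Type*} [CommRing R] [IsLocalRing R] [CommRing A] [CommRing W] [CommRing B]
  [Algebra R A] [Algebra A W] {I : Ideal W}

/-- Every element of a localization of a quotient of the completion is associated to an element
of `A`. -/
theorem exists_mul_unit [IsNoetherianRing R] [IsAdicComplete (maximalIdeal R) R]
    [Algebra.FiniteType R A] [IsLocalRing B] [IsDomain B] [IsNoetherianRing B]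
    (h : HasDenominators A I)
    (hI : I = ((maximalIdeal R).map (algebraMap R A)).map (algebraMap A W))
    {t : R} (htm : t ∈ maximalIdeal R) (ht : maximalIdeal R ≤ (Ideal.span {t}).radical)
    (hdim : ∀ p q : Ideal A, p.IsPrime → q.IsPrime →
      (maximalIdeal R).map (algebraMap R A) ≤ p → p < q → q.IsMaximal)
    (Q : Ideal (AdicCompletion I W)) [Q.IsMaximal] (ψ : AdicCompletion I W →+* B)
    (hψ : ∀ z, IsUnit (ψ z) ↔ z ∉ Q) (hψs : ∀ y, ∃ x z, z ∉ Q ∧ ψ z * y = ψ x) (b : B) :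
    ∃ (a : A) (u : Bˣ), b = ψ (algebraMap W _ (algebraMap A W a)) * u := by
  have hIfg : I.FG := hI ▸
    (((maximalIdeal R).fg_of_isNoetherianRing).map (algebraMap R A)).map (algebraMap A W)
  have hIQ := AdicCompletion.le_of_isMaximal hIfg Q
  let f : A →+* B := (ψ.comp (algebraMap W (AdicCompletion I W))).comp (algebraMap A W)
  let : Algebra A B := f.toAlgebra
  let : Algebra R B := (f.comp (algebraMap R A)).toAlgebra
  have : IsScalarTower R A B := IsScalarTower.of_algebraMap_eq' rfl
  have hf : ∀ a, algebraMap A B a = ψ (algebraMap W _ (algebraMap A W a)) := fun _ => rfl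
  have hmB : (maximalIdeal R).map (algebraMap R B) =
      (I.map (algebraMap W (AdicCompletion I W))).map ψ := by
    have e := congrArg (Ideal.map (ψ.comp (algebraMap W (AdicCompletion I W)))) hI
    rw [Ideal.map_map, e, Ideal.map_map, Ideal.map_map]
    rfl
  set N := Q.comap (algebraMap W (AdicCompletion I W)) with hN
  have hNp : N.IsPrime := inferInstance
  have hIN : I ≤ N := Ideal.map_le_iff_le_comap.1 hIQ
  have hunit : ∀ s : A, algebraMap A W s ∉ N → IsUnit (algebraMap A B s) := fun s hs =>
    (hψ _).2 hs
  refine exists_algebraMap_mul_unit_of_dense htm ht hdim ?_ ?_ b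
  · rw [hmB]
    refine fun htop => (maximalIdeal.isMaximal B).ne_top (top_le_iff.1 (htop ▸ ?_))
    rw [Ideal.map_le_iff_le_comap]
    refine hIQ.trans fun z hz => ?_
    rw [Ideal.mem_comap, mem_maximalIdeal, mem_nonunits_iff, hψ]
    exact not_not.2 hz
  · intro y n
    rw [hmB, ← Ideal.map_pow]
    obtain ⟨x, z, hz, hy⟩ := hψs y
    obtain ⟨w, hw⟩ := AdicCompletion.exists_sub_algebraMap_mem hIfg n x
    obtain ⟨v, hv⟩ := AdicCompletion.exists_sub_algebraMap_mem hIfg (n + 1) z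
    have hvN : v ∉ N := fun hvN => hz (by
      have := Q.add_mem (hIQ (Ideal.pow_le_self n.succ_ne_zero hv)) hvN
      rwa [sub_add_cancel] at this)
    obtain ⟨s, a, hs, hsa⟩ := h w N hNp hIN
    obtain ⟨s', a', hs', hsa'⟩ := h v N hNp hIN
    have ha' : algebraMap A W a' ∉ N := hsa' ▸ hNp.mul_notMem hs' hvN
    -- `y = x / z` is close to `w / v = (a / s) / (a' / s')`. The precision `n + 1` for `v` ensures
    -- `v ∉ N` even when `n = 0`.
    refine ⟨a' * s, a * s', hunit _ (by rw [map_mul]; exact hNp.mul_notMem ha' hs), ?_⟩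
    have h1 := Ideal.mem_map_of_mem ψ hw
    have h2 := Ideal.mem_map_of_mem ψ (Ideal.pow_le_pow_right n.le_succ hv)
    rw [map_sub] at h1 h2
    have h3 := Ideal.sub_mem _ (Ideal.mul_mem_left _ (algebraMap A B s * algebraMap A B s') h1)
      (Ideal.mul_mem_left _ (algebraMap A B s * algebraMap A B s' * y) h2)
    convert h3 using 1
    rw [map_mul, map_mul]
    have e1 : algebraMap A B a = algebraMap A B s * ψ (algebraMap W _ w) := by
      rw [hf, hf, ← hsa, map_mul, map_mul]
    have e2 : algebraMap A B a' = algebraMap A B s' * ψ (algebraMap W _ v) := by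
      rw [hf, hf, ← hsa', map_mul, map_mul]
    rw [e1, e2, ← hy]
    ring

end HasDenominators

/-- The localization `(B / P)_Q` is the localization at a prime ideal. -/
theorem algebraMapSubmonoid_primeCompl_quotient {B : Type*} [CommRing B] {P Q : Ideal B}
    [Q.IsPrime] (hPQ : P ≤ Q) [hQ : (Q.map (Ideal.Quotient.mk P)).IsPrime] :
    Algebra.algebraMapSubmonoid (B ⧸ P) Q.primeCompl =
      (Q.map (Ideal.Quotient.mk P)).primeCompl := by
  have hc : (Q.map (Ideal.Quotient.mk P)).comap (Ideal.Quotient.mk P) = Q := by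
    rw [Ideal.comap_map_of_surjective _ Ideal.Quotient.mk_surjective, ← RingHom.ker_eq_comap_bot,
      Ideal.mk_ker, sup_eq_left.2 hPQ]
  ext y
  constructor
  · rintro ⟨z, hz, rfl⟩ hzQ
    exact hz (hc ▸ hzQ)
  · obtain ⟨z, rfl⟩ := Ideal.Quotient.mk_surjective y
    exact fun hz => ⟨z, fun hzQ => hz (Ideal.mem_map_of_mem _ hzQ), rfl⟩

namespace HasDenominators

variable {R A : Type*} {W : Type u} [CommRing R] [IsLocalRing R] [CommRing A] [CommRing W]
  [Algebra R A] [Algebra A W] {I : Ideal W}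

/-- The theorem in purely algebraic form: the curve enters only through `HasDenominators` and the
chain condition `hdim`. -/
theorem injective_and_isWeierstrass [IsNoetherianRing R] [IsAdicComplete (maximalIdeal R) R]
    [Algebra.FiniteType R A] [IsDomain W] (h : HasDenominators A I)
    (hI : I = ((maximalIdeal R).map (algebraMap R A)).map (algebraMap A W))
    {t : R} (htm : t ∈ maximalIdeal R) (ht : maximalIdeal R ≤ (Ideal.span {t}).radical)
    (hdim : ∀ p q : Ideal A, p.IsPrime → q.IsPrime →
      (maximalIdeal R).map (algebraMap R A) ≤ p → p < q → q.IsMaximal)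
    (Q P : Ideal (AdicCompletion I W)) [Q.IsMaximal]
    (hP : P ∈ minimalPrimes (AdicCompletion I W)) (hPQ : P ≤ Q)
    {φ : W →+* QuotientLocalization P Q}
    (hφ : φ = ((algebraMap (AdicCompletion I W ⧸ P) (QuotientLocalization P Q)).comp
      (Ideal.Quotient.mk P)).comp (algebraMap W (AdicCompletion I W))) :
    Function.Injective φ ∧ IsWeierstrass φ := by
  have hA : IsNoetherianRing A := Algebra.FiniteType.isNoetherianRing R A
  have hIfg : I.FG := hI ▸
    (((maximalIdeal R).fg_of_isNoetherianRing).map (algebraMap R A)).map (algebraMap A W)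
  have hN : IsNoetherianRing (AdicCompletion I W) := by
    refine h.isNoetherianRing_adicCompletion hI
      (Ideal.mem_map_of_mem (algebraMap R A) htm) ?_
    rw [Ideal.map_le_iff_le_comap]
    intro r hr
    obtain ⟨n, hn⟩ := ht hr
    refine ⟨n, ?_⟩
    rw [← map_pow]
    simpa only [Ideal.map_span, Set.image_singleton] using
      Ideal.mem_map_of_mem (algebraMap R A) hn
  have hPp : P.IsPrime := hP.isPrime
  have hQp : (Q.map (Ideal.Quotient.mk P)).IsPrime :=
    Ideal.map_isPrime_of_surjective Ideal.Quotient.mk_surjective (Ideal.mk_ker.trans_le hPQ)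
  have hS := algebraMapSubmonoid_primeCompl_quotient hPQ
  have hle : Algebra.algebraMapSubmonoid (AdicCompletion I W ⧸ P) Q.primeCompl ≤
      nonZeroDivisors _ := by
    rw [hS]
    exact Ideal.primeCompl_le_nonZeroDivisors _
  have hD : IsDomain (QuotientLocalization P Q) := IsLocalization.isDomain_localization hle
  have hAt : IsLocalization.AtPrime (QuotientLocalization P Q) (Q.map (Ideal.Quotient.mk P)) := by
    rw [IsLocalization.AtPrime, ← hS]
    infer_instance
  have hL : IsLocalRing (QuotientLocalization P Q) :=
    IsLocalization.AtPrime.isLocalRing _ (Q.map (Ideal.Quotient.mk P))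
  have hNB : IsNoetherianRing (QuotientLocalization P Q) :=
    IsLocalization.isNoetherianRing
      (Algebra.algebraMapSubmonoid (AdicCompletion I W ⧸ P) Q.primeCompl) _ inferInstance
  have hinj : Function.Injective (algebraMap (AdicCompletion I W ⧸ P) (QuotientLocalization P Q)) :=
    IsLocalization.injective _ hle
  let ψ : AdicCompletion I W →+* QuotientLocalization P Q :=
    (algebraMap (AdicCompletion I W ⧸ P) (QuotientLocalization P Q)).comp (Ideal.Quotient.mk P)
  have hψ : ∀ z, IsUnit (ψ z) ↔ z ∉ Q := fun z => by
    rw [RingHom.comp_apply, IsLocalization.AtPrime.isUnit_to_map_iff _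
      (Q.map (Ideal.Quotient.mk P)), ← hS]
    constructor
    · intro hz hzQ
      rw [hS] at hz
      exact hz (Ideal.mem_map_of_mem _ hzQ)
    · exact fun hz => ⟨z, hz, rfl⟩
  have hψs : ∀ y, ∃ x z, z ∉ Q ∧ ψ z * y = ψ x := fun y => by
    obtain ⟨⟨x, ⟨_, z, hz, rfl⟩⟩, hx⟩ := IsLocalization.surj
      (Algebra.algebraMapSubmonoid (AdicCompletion I W ⧸ P) Q.primeCompl) y
    obtain ⟨x, rfl⟩ := Ideal.Quotient.mk_surjective x
    exact ⟨x, z, hz, (mul_comm _ _).trans hx⟩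
  subst hφ
  constructor
  · rw [injective_iff_map_eq_zero]
    intro w hw
    refine h.eq_zero_of_algebraMap_mem_minimalPrimes hIfg hP hPQ ?_
    exact Ideal.Quotient.eq_zero_iff_mem.1 (hinj (hw.trans (map_zero _).symm))
  · intro b
    obtain ⟨a, u, hu⟩ := h.exists_mul_unit hI htm ht hdim Q ψ hψ hψs b
    exact ⟨_, u, hu⟩

end HasDenominators

/-! ### From the curve to an affine algebra -/

/-- In a one-dimensional local domain some principal ideal has the maximal ideal as radical. -/
theorem exists_maximalIdeal_le_radical_span {R : Type*} [CommRing R] [IsDomain R] [IsLocalRing R]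
    (hdim : ringKrullDim R = 1) :
    ∃ t ∈ maximalIdeal R, t ≠ 0 ∧ maximalIdeal R ≤ (Ideal.span {t}).radical := by
  have h1 : Ring.KrullDimLE 1 R := (Order.krullDimLE_iff 1 _).2 hdim.le
  have hne : maximalIdeal R ≠ ⊥ := fun h => by
    have := ringKrullDim_eq_zero_of_isField (IsLocalRing.isField_iff_maximalIdeal_eq.2 h)
    rw [hdim] at this
    exact one_ne_zero this
  obtain ⟨t, ht, ht0⟩ := Submodule.exists_mem_ne_zero_of_ne_bot hne
  refine ⟨t, ht, ht0, ?_⟩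
  rw [Ideal.radical_eq_sInf]
  refine le_sInf fun p ⟨htp, hp⟩ => ?_
  have hp0 : p ≠ ⊥ := fun h => ht0 (by
    rw [h] at htp
    exact htp (Ideal.mem_span_singleton_self t))
  exact (eq_maximalIdeal (hp.isMaximal_of_ne_bot hp0)).symm.le

/-- A chain of two proper specializations forces the dimension to be at least two. -/
theorem two_le_topologicalKrullDim {T : Type*} [TopologicalSpace T] {x y z : T} (hxy : x ⤳ y)
    (hyx : ¬ y ⤳ x) (hyz : y ⤳ z) (hzy : ¬ z ⤳ y) : 2 ≤ topologicalKrullDim T := by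
  let c : T → TopologicalSpace.IrreducibleCloseds T := fun a =>
    ⟨closure {a}, isIrreducible_singleton.closure, isClosed_closure⟩
  have hc : ∀ {a b : T}, a ⤳ b → ¬ b ⤳ a → c b < c a := fun {a b} hab hba =>
    lt_of_le_not_ge hab.closure_subset fun h =>
      hba (specializes_iff_closure_subset.2 h)
  let l : LTSeries (TopologicalSpace.IrreducibleCloseds T) :=
    { length := 2
      toFun := ![c z, c y, c x]
      step := Fin.forall_fin_two.2 ⟨hc hyz hzy, hc hxy hyx⟩ }
  exact Order.LTSeries.length_le_krullDim l

theorem IsProjectiveOver.locallyOfFiniteType {R : Type u} [CommRing R] {X : Scheme.{u}}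
    {f : X ⟶ Spec (.of R)} (hf : IsProjectiveOver f) : LocallyOfFiniteType f := by
  obtain ⟨n, i, hi, rfl⟩ := hf
  let 𝒜 := MvPolynomial.homogeneousSubmodule (Fin (n + 1)) R
  have : IsScalarTower R (𝒜 0) (MvPolynomial (Fin (n + 1)) R) :=
    ⟨fun r a p => smul_mul_assoc r (a : MvPolynomial (Fin (n + 1)) R) p⟩
  have hfin : Algebra.FiniteType (𝒜 0) (MvPolynomial (Fin (n + 1)) R) :=
    Algebra.FiniteType.of_restrictScalars_finiteType R (𝒜 0) (MvPolynomial (Fin (n + 1)) R)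
  have hsurj : Function.Surjective (algebraMap R (𝒜 0)) := by
    rintro ⟨p, hp⟩
    have hp' : p ∈ MvPolynomial.homogeneousSubmodule (Fin (n + 1)) R 0 := hp
    rw [MvPolynomial.homogeneousSubmodule_zero] at hp'
    obtain ⟨r, rfl⟩ := Submodule.mem_one.1 hp'
    exact ⟨r, rfl⟩
  have h0 : IsProper (Proj.toSpecZero 𝒜) := inferInstance
  have h1 : IsClosedImmersion (Spec.map (CommRingCat.ofHom (algebraMap R (𝒜 0)))) :=
    IsClosedImmersion.spec_of_surjective _ hsurj
  have h2 : LocallyOfFiniteType (projSpaceToSpec R n) :=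
    MorphismProperty.comp_mem (W := @LocallyOfFiniteType) (Proj.toSpecZero 𝒜) _
      inferInstance inferInstance
  infer_instance

namespace ProjectiveNormalCurve

variable {R : Type u} [CommRing R] (C : ProjectiveNormalCurve R) {V : C.X.Opens}

/-- The canonical homomorphism from `R` to the sections over an open subset. -/
noncomputable def toSections (V : C.X.Opens) : R →+* Γ(C.X, V) :=
  (C.f.appLE ⊤ V le_top).hom.comp (Scheme.ΓSpecIso (.of R)).inv.hom

theorem fromSpec_comp (hV : IsAffineOpen V) :
    hV.fromSpec ≫ C.f = Spec.map (CommRingCat.ofHom (C.toSections V)) := by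
  rw [← IsAffineOpen.SpecMap_appLE_fromSpec C.f (isAffineOpen_top _) hV le_top,
    IsAffineOpen.fromSpec_top, Scheme.isoSpec_Spec_inv, ← Spec.map_comp]
  rfl

theorem finiteType_toSections (hV : IsAffineOpen V) : (C.toSections V).FiniteType := by
  have := C.projective.locallyOfFiniteType
  have h : LocallyOfFiniteType (Spec.map (CommRingCat.ofHom (C.toSections V))) := by
    rw [← C.fromSpec_comp hV]
    infer_instance
  exact (HasRingHomProperty.Spec_iff (P := @LocallyOfFiniteType)).1 h

theorem apply_fromSpec (hV : IsAffineOpen V) (p : PrimeSpectrum Γ(C.X, V)) :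
    C.f (hV.fromSpec p) = p.comap (C.toSections V) :=
  (Scheme.Hom.comp_apply hV.fromSpec C.f p).symm.trans (by rw [C.fromSpec_comp hV]; rfl)

theorem apply_fromSpec_eq_closedPoint_iff [IsLocalRing R] (hV : IsAffineOpen V)
    (p : PrimeSpectrum Γ(C.X, V)) :
    C.f (hV.fromSpec p) = closedPoint R ↔
      (maximalIdeal R).map (C.toSections V) ≤ p.asIdeal := by
  rw [C.apply_fromSpec hV, Ideal.map_le_iff_le_comap]
  constructor
  · intro h
    exact (congrArg PrimeSpectrum.asIdeal h).symm.le
  · intro h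
    exact PrimeSpectrum.ext (le_antisymm
      (le_maximalIdeal (p.comap (C.toSections V)).2.ne_top) h)

/-- Otherwise `p < q < n` with `n` maximal would be a chain of specializations of length two in the
closed fiber, which has dimension one. -/
theorem isMaximal_of_lt [IsLocalRing R] (hV : IsAffineOpen V) (p q : Ideal Γ(C.X, V))
    (hp : p.IsPrime) (hq : q.IsPrime) (hmp : (maximalIdeal R).map (C.toSections V) ≤ p)
    (hpq : p < q) : q.IsMaximal := by
  obtain ⟨n, hn, hqn⟩ := Ideal.exists_le_maximal q hq.ne_top
  rcases hqn.eq_or_lt with rfl | hlt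
  · exact hn
  exfalso
  let y : Spec (.of R) := closedPoint R
  have hx : ∀ p : PrimeSpectrum Γ(C.X, V),
      (maximalIdeal R).map (C.toSections V) ≤ p.asIdeal →
      ∃ x : C.f.fiber y, C.f.fiberι y x = hV.fromSpec p := fun p h => by
    have := (C.apply_fromSpec_eq_closedPoint_iff hV p).2 h
    have h' : hV.fromSpec p ∈ Set.range (C.f.fiberι y) := by
      rw [Scheme.Hom.range_fiberι]
      exact this
    exact h'
  have hs : ∀ {p q : PrimeSpectrum Γ(C.X, V)} {a b : C.f.fiber y},
      C.f.fiberι y a = hV.fromSpec p → C.f.fiberι y b = hV.fromSpec q →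
      (a ⤳ b ↔ p.asIdeal ≤ q.asIdeal) := fun {p q a b} ha hb => by
    rw [← (C.f.fiberι y).isEmbedding.isInducing.specializes_iff, ha, hb]
    exact hV.fromSpec.isOpenEmbedding.isInducing.specializes_iff.trans
      (PrimeSpectrum.le_iff_specializes p q).symm
  obtain ⟨a, ha⟩ := hx ⟨p, hp⟩ hmp
  obtain ⟨b, hb⟩ := hx ⟨q, hq⟩ (hmp.trans hpq.le)
  obtain ⟨c, hc⟩ := hx ⟨n, hn.isPrime⟩ (hmp.trans (hpq.le.trans hlt.le))
  have h2 := two_le_topologicalKrullDim ((hs ha hb).2 hpq.le)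
    (fun h => hpq.not_ge ((hs hb ha).1 h)) ((hs hb hc).2 hlt.le)
    (fun h => hlt.not_ge ((hs hc hb).1 h))
  rw [C.fiber_dim] at h2
  exact absurd h2 (by norm_num)

variable [IsNoetherianRing R]

theorem germToFunctionField_toSections [Nonempty V] (r : R) :
    C.X.germToFunctionField V (C.toSections V r) = C.toFunctionField r := by
  have : Nonempty (⊤ : C.X.Opens) := ⟨⟨genericPoint C.X, trivial⟩⟩
  simp only [toSections, toFunctionField, RingHom.comp_apply, Scheme.Hom.appLE,
    CommRingCat.hom_comp, Scheme.germToFunctionField]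
  exact TopCat.Presheaf.germ_res_apply _ _ _ _ _

/-- If `t ≠ 0` vanished on `V`, the preimage of its basic open set would miss `V`. That preimage is
nonempty by dominance, so it meets `V` by irreducibility. -/
theorem toSections_injective [IsDomain R] (hV : IsAffineOpen V) [Nonempty V] :
    Function.Injective (C.toSections V) := by
  rw [injective_iff_map_eq_zero]
  intro t ht
  by_contra h0
  let D : (Spec (.of R)).Opens := PrimeSpectrum.basicOpen t
  have hD : (D : Set (Spec (.of R))).Nonempty := ⟨(⊥ : PrimeSpectrum R), h0⟩
  obtain ⟨x, hx⟩ := C.dominant.denseRange.exists_mem_open D.isOpen hD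
  have hVne : (V : Set C.X).Nonempty := Set.nonempty_coe_sort.1 ‹_›
  obtain ⟨z, hzV, hzD⟩ := nonempty_preirreducible_inter V.isOpen (C.f ⁻¹ᵁ D).isOpen hVne ⟨x, hx⟩
  have h1 := C.apply_fromSpec hV (hV.primeIdealOf ⟨z, hzV⟩)
  rw [hV.fromSpec_primeIdealOf] at h1
  have h2 : C.f z ∈ PrimeSpectrum.basicOpen t := hzD
  rw [h1] at h2
  refine h2 ?_
  rw [PrimeSpectrum.comap_asIdeal, Ideal.mem_comap, ht]
  exact Ideal.zero_mem _

/-- Stalks at points of `V` are localizations of the sections over `V`; this translates regularity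
into the form used by `exists_comap_le_of_regular`. -/
theorem mem_regularOn_iff (hV : IsAffineOpen V) [Nonempty V] {U : Set C.X} (hUV : U ⊆ V)
    (w : C.X.functionField) :
    w ∈ C.regularOn U ↔ ∀ (x : C.X) (hx : x ∈ U), ∃ a s : Γ(C.X, V),
      s ∉ (hV.primeIdealOf ⟨x, hUV hx⟩).asIdeal ∧
        algebraMap _ C.X.functionField s * w = algebraMap _ C.X.functionField a := by
  have hfr := functionField_isFractionRing_of_isAffineOpen C.X V hV
  simp only [regularOn, Subring.mem_iInf]
  refine forall₂_congr fun x hx => ?_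
  let x' : V := ⟨x, hUV hx⟩
  let : Algebra Γ(C.X, V) (C.X.presheaf.stalk x) := C.X.presheaf.algebra_section_stalk x'
  have hloc : IsLocalization.AtPrime (C.X.presheaf.stalk x) (hV.primeIdealOf x').asIdeal :=
    hV.isLocalization_stalk x'
  have htow : IsScalarTower Γ(C.X, V) (C.X.presheaf.stalk x) C.X.functionField :=
    functionField_isScalarTower C.X V x'
  constructor
  · rintro ⟨g, rfl⟩
    obtain ⟨⟨a, s⟩, h⟩ := IsLocalization.surj (hV.primeIdealOf x').asIdeal.primeCompl g
    refine ⟨a, s, s.2, ?_⟩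
    rw [IsScalarTower.algebraMap_apply _ (C.X.presheaf.stalk x), ← map_mul, mul_comm, h,
      ← IsScalarTower.algebraMap_apply]
  · rintro ⟨a, s, hs, h⟩
    refine ⟨IsLocalization.mk' _ a (⟨s, hs⟩ : (hV.primeIdealOf x').asIdeal.primeCompl), ?_⟩
    have hs0 : algebraMap _ C.X.functionField s ≠ 0 := fun h0 => hs (by
      rw [(IsFractionRing.injective Γ(C.X, V) C.X.functionField) (h0.trans (map_zero _).symm)]
      exact Ideal.zero_mem _)
    refine mul_left_cancel₀ hs0 ?_
    rw [h, IsScalarTower.algebraMap_apply _ (C.X.presheaf.stalk x), ← map_mul,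
      IsScalarTower.algebraMap_apply _ (C.X.presheaf.stalk x) C.X.functionField a]
    exact congrArg _ (IsLocalization.mk'_spec' (C.X.presheaf.stalk x) a
      (⟨s, hs⟩ : (hV.primeIdealOf x').asIdeal.primeCompl))

end ProjectiveNormalCurve

theorem theorem3p6 {R : Type u} [CommRing R] [IsDomain R] [IsLocalRing R] [IsNoetherianRing R]
    [IsAdicComplete (IsLocalRing.maximalIdeal R) R] (hdim : ringKrullDim R = 1)
    (C : ProjectiveNormalCurve R) (U : Set C.X) (hU : U ⊆ C.closedFiber)
    (hUaff : ∃ V : C.X.Opens, IsAffineOpen V ∧ U ⊆ V)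
    (Q P : Ideal (C.completionOn U)) [Q.IsMaximal]
    (hP : P ∈ minimalPrimes (C.completionOn U)) (hPQ : P ≤ Q) :
    Function.Injective (C.toLocalization U P Q) ∧
      IsWeierstrass (C.toLocalization U P Q) := by
  obtain ⟨V, hV, hUV, hne⟩ : ∃ V : C.X.Opens, IsAffineOpen V ∧ U ⊆ V ∧ Nonempty V := by
    obtain ⟨V, hV, hUV⟩ := hUaff
    -- If `V` is empty then so is `U`, and any affine neighbourhood of the generic point serves
    -- instead.
    by_cases hne : Nonempty V
    · exact ⟨V, hV, hUV, hne⟩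
    · obtain ⟨V', hV', hx, -⟩ := exists_isAffineOpen_mem_and_subset
        (x := genericPoint C.X) (U := ⊤) trivial
      exact ⟨V', hV', fun u hu => (hne ⟨⟨u, hUV hu⟩⟩).elim, ⟨⟨_, hx⟩⟩⟩
  obtain ⟨t, htm, ht0, ht⟩ := exists_maximalIdeal_le_radical_span hdim
  let : Algebra R Γ(C.X, V) := (C.toSections V).toAlgebra
  have hfr := functionField_isFractionRing_of_isAffineOpen C.X V hV
  have hft : Algebra.FiniteType R Γ(C.X, V) := C.finiteType_toSections hV
  let : Algebra Γ(C.X, V) (C.regularOn U) :=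
    ((algebraMap Γ(C.X, V) C.X.functionField).codRestrict (C.regularOn U) fun a =>
      (C.mem_regularOn_iff hV hUV _).2 fun x hx =>
        ⟨a, 1, (Ideal.ne_top_iff_one _).1 (hV.primeIdealOf _).2.ne_top, by simp⟩).toAlgebra
  have htow : IsScalarTower Γ(C.X, V) (C.regularOn U) C.X.functionField :=
    IsScalarTower.of_algebraMap_eq' rfl
  have hI : C.idealOn U = ((maximalIdeal R).map (algebraMap R Γ(C.X, V))).map
      (algebraMap Γ(C.X, V) (C.regularOn U)) := by
    rw [Ideal.map_map]
    refine congrArg (fun g : R →+* C.regularOn U => (maximalIdeal R).map g) ?_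
    ext r
    exact (C.germToFunctionField_toSections r).symm
  let Y : Set (Ideal Γ(C.X, V)) := {p | ∃ (x : C.X) (hx : x ∈ U),
    p = (hV.primeIdealOf ⟨x, hUV hx⟩).asIdeal}
  have hden : HasDenominators Γ(C.X, V) (C.idealOn U) := by
    intro w N hN hIN
    obtain ⟨_, ⟨x, hx, rfl⟩, hle⟩ := exists_comap_le_of_regular (R := R) (K := C.X.functionField)
      (Y := Y) (by rintro _ ⟨x, hx, rfl⟩; exact (hV.primeIdealOf _).2)
      (by
        rintro _ ⟨x, hx, rfl⟩
        refine (C.apply_fromSpec_eq_closedPoint_iff hV _).1 ?_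
        rw [hV.fromSpec_primeIdealOf]
        exact hU hx)
      (C.isMaximal_of_lt hV)
      (fun h => ht0 (C.toSections_injective hV (((Submodule.mem_bot _).1
        (h ▸ Ideal.mem_map_of_mem (algebraMap R Γ(C.X, V)) htm)).trans (map_zero _).symm)))
      (W := C.regularOn U)
      (fun f hf => ⟨⟨f, (C.mem_regularOn_iff hV hUV f).2 fun x hx => hf _ ⟨x, hx, rfl⟩⟩, rfl⟩)
      N (by rw [← Ideal.map_le_iff_le_comap, ← hI]; exact hIN)
    -- A denominator of `w` at the point `x` works at `N`, since the contraction of `N` is contained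
    -- in the prime of `x`.
    obtain ⟨a, s, hs, h⟩ := (C.mem_regularOn_iff hV hUV w).1 w.2 x hx
    exact ⟨s, a, fun hsN => hs (hle hsN), Subtype.ext h⟩
  exact hden.injective_and_isWeierstrass hI htm ht (C.isMaximal_of_lt hV) Q P hP hPQ rfl
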